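/- **Justification logic.** Terms are built from constants, variables, $[t+s]$, $[t\cdot s]$ and $!t$; formulas are built from $\bot$ and propositional variables with $\neg,\to,\wedge,\vee$ and $t{:}_i\varphi$, where $i$ is an agent. The logic $J_H$ has agents $1,2,3,4$ with $\subset\,=\{(3,4)\}$ and $\hookleftarrow\,=\{(1,2),(2,3),(4,4)\}$ ($i\hookleftarrow j$ means $j\hookrightarrow i$). Its axiom schemes are: any finite list of schemes that (with modus ponens) is sound and complete for classical propositional logic; for every agent $i$, $s{:}_i(\varphi\to\chi)\to(t{:}_i\varphi\to[s\cdot t]{:}_i\chi)$, $s{:}_i\varphi\to[s+t]{:}_i\varphi$, $s{:}_i\varphi\to[t+s]{:}_i\varphi$; $t{:}_i\bot\to\bot$ for $i=3,4$; $t{:}_4\varphi\to t{:}_3\varphi$; and $t{:}_i\varphi\to{!t}{:}_j\,t{:}_i\varphi$ for $i\hookleftarrow j$. Let $\mathcal{CS}$ be a constant specification that is schematic (for each agent, each constant justifies exactly the instances of some set of axiom schemes) and axiomatically appropriate (for each agent, each axiom is justified by some constant). Axiom Necessitation gives the formulas $c{:}_iA\in\mathcal{CS}$ and $!s{:}_i\,s{:}_j\varphi$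 for each instance $s{:}_j\varphi$ of Axiom Necessitation. An F-model consists of a set $W\ne\emptyset$, relations $R_i$ and sets $\mathcal A_i(t,\varphi)\subseteq W$, and a valuation of the propositional variables such that: $\mathcal A_i(s,\varphi\to\chi)\cap\mathcal A_i(t,\varphi)\subseteq\mathcal A_i(s\cdot t,\chi)$; $\mathcal A_i(s,\varphi)\cup\mathcal A_i(t,\varphi)\subseteq\mathcal A_i(s+t,\varphi)$; $\mathcal A_i(t,\varphi)=W$ for instances $t{:}_i\varphi$ of Axiom Necessitation; if $i\hookrightarrow j$, then $\mathcal A_j(t,\varphi)\subseteq\mathcal A_i(!t,t{:}_j\varphi)$, $\mathcal A_j(t,\varphi)$ is closed under $R_i$-successors, and $aR_ibR_jc$ implies $aR_jc$; $\mathcal A_4(t,\varphi)\subseteq\mathcal A_3(t,\varphi)$ and $R_3\subseteq R_4$; $R_3,R_4$ are serial. $a\models t{:}_i\varphi$ iff $a\in\mathcal A_i(t,\varphi)$ and $b\models\varphi$ whenever $aR_ib$; the connectives are classical. $J_H$-satisfiable means true at some state of some F-model. **First-order formula.** Let $\phi=\exists x_1\cdots\exists x_k\forall y_1\cdots\forall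 y_{k'}\,\psi$, $k+k'\ge1$, where $\psi$ is built by $\neg,\vee,\wedge,\to$ from atoms $R_r(\vec z)$ with relation symbols $R_1,\dots,R_m$ of arities $a_1,\dots,a_m$ (no equality, constants or function symbols). Put $n=\max_r a_r$ ($0$ if $m=0$), $\rho_0=k+k'$, $(z_1,\dots,z_{\rho_0})=(x_1,\dots,x_k,y_1,\dots,y_{k'})$. Let $\psi_1,\dots,\psi_l$ list the subformulas of $\neg\psi$ without repetition, in non-decreasing order of some size that is $1$ on atoms and strictly larger on a formula than on its proper subformulas; let $\psi_1,\dots,\psi_q$ be the atoms. **Terms.** Conjunctions, $+$ and $\cdot$ associate to the left; the empty conjunction is true and the empty disjunction false. $\mathit{append}$, $\mathit{hypappend}$, $\mathit{appendconc}$, $\mathit{left}$, $\mathit{right}$, $\mathit{id}$, $\mathit{tran}$, $\mathit{addhyp}$, $\mathit{replaceleft}$, $\mathit{replaceright}$, $\mathit{mphypoth}$ are any terms without justification variables that, provably in $J_H$, justify for agents $1$ and $2$ all instances of, respectively: $A\to(B\to A\wedge B)$; $(A\to B)\to(A\to A\wedge B)$; $(A\to B)\to((A\to C)\to(A\to B\wedge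 C))$; $A\wedge B\to A$; $A\wedge B\to B$; $A\to A$; $(A\to B)\to((B\to C)\to(A\to C))$; $A\to(B\to A)$; $(A\to A')\to(A\wedge B\to A'\wedge B)$; $(B\to B')\to(A\wedge B\to A\wedge B')$; $(A\to B)\to((A\to(B\to C))\to(A\to C))$. $c_\cdot$ is a constant with $c_\cdot{:}_2(s{:}_1(A\to B)\to(t{:}_1A\to[s\cdot t]{:}_1B))\in\mathcal{CS}$ for all $s,t,A,B$. Put $proj^1_1=replace^1_1=id$; for $r>1$, $proj^r_r=right$, $replace^r_r=replaceright$; for $b<r$, $proj^r_b=tran\cdot left\cdot proj^{r-1}_b$ and $replace^r_b=tran\cdot replace^{r-1}_b\cdot replaceleft$. Let $\rho$, $var_a$, $rel_r$, $value_z$, $match(z,p_b)$, $truth_a$ be distinct justification variables and $[active]$, $p_a$, $ok_a$, $[z]^\triangle$, $[R_r]^\triangle$, $[\psi_a]^\triangle$ ($\triangle\in\{\top,\bot\}$) distinct propositional variables; write $[p_a]^\top=p_a$, $[p_a]^\bot=\neg p_a$. For a list of terms, $append(t_1)=t_1$ and $append(t_1,\dots,t_{j+1})=append\cdot append(t_1,\dots,t_j)\cdot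 t_{j+1}$; similarly for $appendconc$. Let $gather_r=append(var_1,\dots,var_{a_r},rel_r)$ and $T^{\rho_0}=append(value_{z_1},\dots,value_{z_{\rho_0}})$. For an atom $A=R_r(w_1,\dots,w_{a_r})$ with $w_b=z_{j_b}$, let $X_b=tran\cdot[tran\cdot proj^{\rho_0}_{j_b}\cdot match(w_b,p_b)]\cdot replace^{a_r+1}_b$, $M_0=addhyp\cdot gather_r$, $M_b=mphypoth\cdot M_{b-1}\cdot X_b$, $M^!_0=c_\cdot\cdot{!addhyp}\cdot{!gather_r}$, $M^!_b=c_\cdot\cdot[c_\cdot\cdot{!mphypoth}\cdot M^!_{b-1}]\cdot{!X_b}$, $match^A=M_{a_r}$, $match^{!A}=M^!_{a_r}$. Let $U_0=appendconc(c_\cdot\cdot match^{!\psi_1},\dots,c_\cdot\cdot match^{!\psi_q})\cdot{!T^{\rho_0}}$; for $1\le a\le q$, $U_a=replace^q_a\cdot truth_a\cdot U_{a-1}$; for $a>q$, $U_a=hypappend\cdot[tran\cdot proj^{a-1}_b\cdot truth_a]\cdot U_{a-1}$ if $\psi_a=\neg\psi_b$, and $U_a=hypappend\cdot[tran\cdot[appendconc\cdot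 proj^{a-1}_b\cdot proj^{a-1}_c]\cdot truth_a]\cdot U_{a-1}$ if $\psi_a=\psi_b\circ\psi_c$, $\circ\in\{\vee,\wedge,\to\}$. Let $t^\phi=right\cdot U_l$. **The formula.** $Match=\bigwedge_{b\le n,\,z,\,\triangle}match(z,p_b){:}_1([z]^\triangle\to([p_b]^\triangle\to ok_b))$. $Eval=\bigwedge_{a\le l}Eval_a$, where $Eval_a$ is: for an atom $\psi_a=R_r(\vec w)$, $\bigwedge_\triangle truth_a{:}_2([match^{\psi_a}\cdot T^{\rho_0}]{:}_1(ok_1\wedge\cdots\wedge ok_{a_r}\wedge[R_r]^\triangle)\to[\psi_a]^\triangle)$; for $\psi_a=\neg\gamma$, $\bigwedge_\triangle truth_a{:}_2([\gamma]^\triangle\to[\psi_a]^{\neg\triangle})$; for $\psi_a=\gamma\circ\delta$, $\bigwedge_{\triangle,\triangle'}truth_a{:}_2([\gamma]^\triangle\wedge[\delta]^{\triangle'}\to[\psi_a]^{\triangle\circ\triangle'})$. With $a,b$ ranging over $1,\dots,n$ (and $b<a$ where indicated), - $start=\neg[active]\wedge\rho{:}_3([active]\wedge\bigwedge_a var_a{:}_1\neg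 p_a)$; - $forward_A=\rho{:}_4\big((\bigvee_a var_a{:}_1\neg p_a)\wedge[active]\to\rho{:}_3[active]\big)$; - $forward_B=\rho{:}_4\bigwedge_a\big(\bigwedge_{b<a}var_b{:}_1p_b\wedge var_a{:}_1\neg p_a\wedge[active]\to\rho{:}_3(\bigwedge_{b<a}var_b{:}_1\neg p_b\wedge var_a{:}_1p_a)\big)$; - $forward_C=\rho{:}_4\bigwedge_a\big((\bigvee_{b<a}var_b{:}_1\neg p_b)\wedge var_a{:}_1\neg p_a\wedge[active]\to\rho{:}_3var_a{:}_1\neg p_a\big)$; - $forward_D=\rho{:}_4\bigwedge_a\big((\bigvee_{b<a}var_b{:}_1\neg p_b)\wedge var_a{:}_1p_a\wedge[active]\to\rho{:}_3var_a{:}_1p_a\big)$; - $end=\rho{:}_4\big(\bigwedge_a var_a{:}_1p_a\wedge[active]\to\rho{:}_4\neg[active]\big)$; - $choice_R=\rho{:}_4\big([active]\to\bigwedge_{r\le m}(rel_r{:}_1[R_r]^\top\vee rel_r{:}_1[R_r]^\bot)\big)$; - $choice_V=\rho{:}_4\big(\neg[active]\to\bigwedge_{i\le k}(value_{x_i}{:}_1[x_i]^\top\vee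 value_{x_i}{:}_1[x_i]^\bot)\wedge\bigwedge_{j\le k'}(value_{y_j}{:}_1[y_j]^\top\wedge value_{y_j}{:}_1[y_j]^\bot)\big)$; - $test=\rho{:}_4\big(\neg[active]\to Match\wedge Eval\wedge\neg\,t^\phi{:}_2[\neg\psi]^\top\big)$. Let $\phi^J_{FO}=start\wedge forward_A\wedge forward_B\wedge forward_C\wedge forward_D\wedge end\wedge choice_R\wedge choice_V\wedge test$. **Theorem.** Terms $append,\dots,mphypoth$, $c_\cdot$ and a list $\psi_1,\dots,\psi_l$ as above exist, and for every choice of them: 1. $\phi^J_{FO}$ is $J_H$-satisfiable if and only if $\phi$ is true in some first-order structure with exactly two elements. 2. If $\phi^J_{FO}$ is true at a state $a$ of an F-model for $J_H$, then there are $2^n+2$ distinct states $a=s_{-1}\,R_3\,s_0\,R_3\cdots R_3\,s_{2^n}$ such that, for $0\le\sigma<2^n$, $[active]$ is true at $s_\sigma$, for each $1\le b\le n$ the formula $var_b{:}_1p_b$ or $var_b{:}_1\neg p_b$ is true at $s_\sigma$ according to whether the $b$-th least significant binary digit of $\sigma$ is $1$ or $0$, and for each $r\le m$ one of $rel_r{:}_1[R_r]^\top$,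 $rel_r{:}_1[R_r]^\bot$ is true at $s_\sigma$; and $[active]$ is false at $s_{2^n}$. -/

import Mathlib

/-! ## Syntax of multi-agent justification logic -/

/-- Justification variables: a fixed countably infinite supply, with readable names. -/
inductive JVar : Type
  | rho : JVar
  | bit (a : ℕ) : JVar
  | rel (r : ℕ) : JVar
  | value (z : ℕ) : JVar
  | mat (z l : ℕ) : JVar
  | truth (a : ℕ) : JVar
  deriving DecidableEq

/-- Propositional variables: a fixed countably infinite supply, with readable names.
`z i △`, `rel r △`, `sub a △` stand for `[z_i]^△`, `[R_r]^△` and `[ψ_a]^△`, where `true` is `⊤`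
and `false` is `⊥`. -/
inductive PVar : Type
  | active : PVar
  | p (l : ℕ) : PVar
  | ok (l : ℕ) : PVar
  | z (i : ℕ) (b : Bool) : PVar
  | rel (r : ℕ) (b : Bool) : PVar
  | sub (a : ℕ) (b : Bool) : PVar
  deriving DecidableEq

/-- Justification terms. -/
inductive JTerm : Type
  | const (c : ℕ) : JTerm
  | var (x : JVar) : JTerm
  | sum (s t : JTerm) : JTerm
  | app (s t : JTerm) : JTerm
  | bang (t : JTerm) : JTerm
  deriving DecidableEq

/-- No justification variable occurs in the term. -/
def JTerm.VarFree : JTerm → Prop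
  | .const _ => True
  | .var _ => False
  | .sum s t => s.VarFree ∧ t.VarFree
  | .app s t => s.VarFree ∧ t.VarFree
  | .bang t => t.VarFree

/-- Formulas over a type `N` of agents; `box t i φ` is `t :_i φ`. -/
inductive JForm (N : Type) : Type
  | bot : JForm N
  | var (p : PVar) : JForm N
  | neg (φ : JForm N) : JForm N
  | imp (φ χ : JForm N) : JForm N
  | and (φ χ : JForm N) : JForm N
  | or (φ χ : JForm N) : JForm N
  | box (t : JTerm) (i : N) (φ : JForm N) : JForm N

/-- Propositional schemes: propositional formulas over metavariables. -/
inductive PScheme : Type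
  | var (n : ℕ) : PScheme
  | bot : PScheme
  | neg (σ : PScheme) : PScheme
  | imp (σ τ : PScheme) : PScheme
  | and (σ τ : PScheme) : PScheme
  | or (σ τ : PScheme) : PScheme

namespace PScheme

/-- Classical truth under a valuation of the metavariables. -/
def Eval (v : ℕ → Prop) : PScheme → Prop
  | var n => v n
  | bot => False
  | neg σ => ¬ σ.Eval v
  | imp σ τ => σ.Eval v → τ.Eval v
  | and σ τ => σ.Eval v ∧ τ.Eval v
  | or σ τ => σ.Eval v ∨ τ.Eval v

def Tautology (σ : PScheme) : Prop := ∀ v, σ.Eval v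

/-- Substitution of propositional schemes for metavariables. -/
def subst (f : ℕ → PScheme) : PScheme → PScheme
  | var n => f n
  | bot => bot
  | neg σ => neg (σ.subst f)
  | imp σ τ => imp (σ.subst f) (τ.subst f)
  | and σ τ => and (σ.subst f) (τ.subst f)
  | or σ τ => or (σ.subst f) (τ.subst f)

/-- Substitution of justification formulas for metavariables. -/
def inst {N : Type} (f : ℕ → JForm N) : PScheme → JForm N
  | var n => f n
  | bot => .bot
  | neg σ => .neg (σ.inst f)
  | imp σ τ => .imp (σ.inst f) (τ.inst f)
  | and σ τ => .and (σ.inst f) (τ.inst f)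
  | or σ τ => .or (σ.inst f) (τ.inst f)

/-- Hilbert derivability from the instances of a set of schemes by modus ponens. -/
inductive Deriv (P : Set PScheme) : PScheme → Prop
  | ax {σ : PScheme} (hσ : σ ∈ P) (f : ℕ → PScheme) : Deriv P (σ.subst f)
  | mp {σ τ : PScheme} : Deriv P (imp σ τ) → Deriv P σ → Deriv P τ

/-- `P` is an axiomatization, by finitely many schemes, of classical propositional logic. -/
structure Axiomatizes (P : Set PScheme) : Prop where
  finite : P.Finite
  sound : ∀ σ ∈ P, σ.Tautology
  complete : ∀ σ : PScheme, σ.Tautology → Deriv P σ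

end PScheme

/-! ## Multi-agent justification logics `(n, ⊂, ↪, F)` and their constant specifications -/

/-- The single-agent logics `J`, `JD`, `JT`. -/
inductive SingleLogic : Type
  | J : SingleLogic
  | JD : SingleLogic
  | JT : SingleLogic

/-- `sub i j` is `i ⊂ j`, `ver i j` is `i ↪ j`, and `P` holds the propositional axiom schemes. -/
structure JLogic (N : Type) where
  sub : N → N → Prop
  ver : N → N → Prop
  F : N → SingleLogic
  P : Set PScheme

/-- Names of axiom schemes. -/
inductive AxScheme (N : Type) : Type
  | prop (σ : PScheme) : AxScheme N
  | application (i : N) : AxScheme N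
  | concatLeft (i : N) : AxScheme N
  | concatRight (i : N) : AxScheme N
  | factivity (i : N) : AxScheme N
  | consistency (i : N) : AxScheme N
  | conversion (i j : N) : AxScheme N
  | verification (i j : N) : AxScheme N

section Logic

variable {N : Type}

open JForm in
/-- The instances of an axiom scheme. -/
def AxScheme.Instances : AxScheme N → Set (JForm N)
  | prop σ => {A | ∃ f : ℕ → JForm N, A = σ.inst f}
  | application i => {A | ∃ s t φ χ,
      A = imp (box s i (imp φ χ)) (imp (box t i φ) (box (.app s t) i χ))}
  | concatLeft i => {A | ∃ s t φ, A = imp (box s i φ) (box (.sum s t) i φ)}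
  | concatRight i => {A | ∃ s t φ, A = imp (box s i φ) (box (.sum t s) i φ)}
  | factivity i => {A | ∃ t φ, A = imp (box t i φ) φ}
  | consistency i => {A | ∃ t, A = imp (box t i bot) bot}
  | conversion i j => {A | ∃ t φ, A = imp (box t i φ) (box t j φ)}
  | verification i j => {A | ∃ t φ, A = imp (box t i φ) (box (.bang t) j (box t i φ))}

/-- The axiom schemes of a justification logic. -/
def JLogic.HasScheme (J : JLogic N) : AxScheme N → Prop
  | .prop σ => σ ∈ J.P
  | .application _ => True
  | .concatLeft _ => True
  | .concatRight _ => True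
  | .factivity i => J.F i = .JT
  | .consistency i => J.F i = .JD
  | .conversion i j => J.sub j i
  | .verification i j => J.ver j i

def JLogic.IsAxiom (J : JLogic N) (A : JForm N) : Prop :=
  ∃ S : AxScheme N, J.HasScheme S ∧ A ∈ S.Instances

/-- `CS c i A` says that `c :_i A` belongs to the constant specification. -/
abbrev ConstSpec (N : Type) : Type := ℕ → N → JForm N → Prop

/-- For each agent, every constant justifies exactly the instances of a certain set of axiom
schemes of the logic. -/
def JLogic.Schematic (J : JLogic N) (CS : ConstSpec N) : Prop :=
  ∀ c i, ∃ T : Set (AxScheme N), (∀ S ∈ T, J.HasScheme S) ∧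
    ∀ A, CS c i A ↔ ∃ S ∈ T, A ∈ S.Instances

/-- For each agent, every axiom is justified by a constant. -/
def JLogic.Appropriate (J : JLogic N) (CS : ConstSpec N) : Prop :=
  ∀ i A, J.IsAxiom A → ∃ c, CS c i A

/-- `AN CS t i φ` says that `t :_i φ` is an instance of Axiom Necessitation. -/
inductive AN (CS : ConstSpec N) : JTerm → N → JForm N → Prop
  | cs {c : ℕ} {i : N} {A : JForm N} : CS c i A → AN CS (.const c) i A
  | bang {s : JTerm} {i j : N} {φ : JForm N} : AN CS s j φ → AN CS (.bang s) i (.box s j φ)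

/-- Theorems of the justification logic with the given constant specification. -/
inductive JLogic.Provable (J : JLogic N) (CS : ConstSpec N) : JForm N → Prop
  | ax {A : JForm N} : J.IsAxiom A → Provable J CS A
  | an {t : JTerm} {i : N} {φ : JForm N} : AN CS t i φ → Provable J CS (.box t i φ)
  | mp {φ χ : JForm N} : Provable J CS (.imp φ χ) → Provable J CS φ → Provable J CS χ

/-! ## Fitting models -/

/-- F-models with universe `W`: accessibility relations `R`, an admissible evidence function `E`
and a valuation `V`. -/
structure FModel (J : JLogic N) (CS : ConstSpec N) (W : Type) where
  R : N → W → W → Prop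
  E : N → JTerm → JForm N → Set W
  V : PVar → Set W
  application : ∀ i s t φ χ, E i s (.imp φ χ) ∩ E i t φ ⊆ E i (.app s t) χ
  sum : ∀ i s t φ, E i s φ ∪ E i t φ ⊆ E i (.sum s t) φ
  an : ∀ t i φ, AN CS t i φ → E i t φ = Set.univ
  verification : ∀ i j, J.ver i j → ∀ t φ, E j t φ ⊆ E i (.bang t) (.box t j φ)
  conversion : ∀ i j, J.sub i j → ∀ t φ, E j t φ ⊆ E i t φ
  distribution : ∀ i j, J.ver j i → ∀ t φ a b, R j a b → a ∈ E i t φ → b ∈ E i t φ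
  reflexive : ∀ i, J.F i = .JT → ∀ a, R i a a
  serial : ∀ i, J.F i = .JD → ∀ a, ∃ b, R i a b
  ver_trans : ∀ i j, J.ver i j → ∀ a b c, R i a b → R j b c → R j a c
  sub_le : ∀ i j, J.sub i j → ∀ a b, R i a b → R j a b

/-- Truth at a state. -/
def FModel.Sat {J : JLogic N} {CS : ConstSpec N} {W : Type} (M : FModel J CS W) :
    JForm N → W → Prop
  | .bot, _ => False
  | .var p, a => a ∈ M.V p
  | .neg φ, a => ¬ M.Sat φ a
  | .imp φ χ, a => M.Sat φ a → M.Sat χ a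
  | .and φ χ, a => M.Sat φ a ∧ M.Sat χ a
  | .or φ χ, a => M.Sat φ a ∨ M.Sat χ a
  | .box t i φ, a => a ∈ M.E i t φ ∧ ∀ b, M.R i a b → M.Sat φ b

def JLogic.Satisfiable (J : JLogic N) (CS : ConstSpec N) (φ : JForm N) : Prop :=
  ∃ (W : Type) (M : FModel J CS W) (a : W), M.Sat φ a

end Logic

/-! ## The logic `J_H` -/

inductive Agent : Type
  | one : Agent
  | two : Agent
  | three : Agent
  | four : Agent
  deriving DecidableEq

/-- `⊂ = {(3,4)}`, `↪ = {(2,1), (3,2), (4,4)}`, agents 1 and 2 are based on `J`, agents 3 and 4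
on `JD`. -/
def JH (P : Set PScheme) : JLogic Agent where
  sub i j := i = .three ∧ j = .four
  ver i j := (i = .two ∧ j = .one) ∨ (i = .three ∧ j = .two) ∨ (i = .four ∧ j = .four)
  F
    | .one => .J
    | .two => .J
    | .three => .JD
    | .four => .JD
  P := P

/-! ## Schönfinkel–Bernays sentences -/

/-- Relational atoms over the relation symbols `R_0, …, R_{m-1}` of arities `ar` and the variables
`z_0, …, z_{k-1} = x_1, …, x_k` and `z_k, …, z_{k+k'-1} = y_1, …, y_{k'}`. -/
structure Atom (m : ℕ) (ar : Fin m → ℕ) (k k' : ℕ) where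
  r : Fin m
  args : Fin (ar r) → Fin (k + k')
  deriving DecidableEq

/-- Quantifier-free matrices without equality. -/
inductive Matr (m : ℕ) (ar : Fin m → ℕ) (k k' : ℕ) : Type
  | atom (A : Atom m ar k k') : Matr m ar k k'
  | neg (γ : Matr m ar k k') : Matr m ar k k'
  | or (γ δ : Matr m ar k k') : Matr m ar k k'
  | and (γ δ : Matr m ar k k') : Matr m ar k k'
  | imp (γ δ : Matr m ar k k') : Matr m ar k k'
  deriving DecidableEq

/-- The first-order language with the relation symbols `R_0, …, R_{m-1}` only. -/
def relLang (m : ℕ) (ar : Fin m → ℕ) : FirstOrder.Language where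
  Functions _ := Empty
  Relations n := {r : Fin m // ar r = n}

section FirstOrderPart

variable {m : ℕ} {ar : Fin m → ℕ} {k k' : ℕ}

/-- The position of a variable in the two blocks of quantifiers. -/
def blockVar (z : Fin (k + k')) : (Empty ⊕ Fin k) ⊕ Fin k' :=
  Fin.addCases (fun i => .inl (.inr i)) (fun j => .inr j) z

def Matr.toFormula : Matr m ar k k' →
    (relLang m ar).Formula ((Empty ⊕ Fin k) ⊕ Fin k')
  | atom A => FirstOrder.Language.Relations.formula (L := relLang m ar) (n := ar A.r)
      (⟨A.r, rfl⟩ : {r : Fin m // ar r = ar A.r}) (fun j => .var (blockVar (A.args j)))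
  | neg γ => γ.toFormula.not
  | or γ δ => γ.toFormula ⊔ δ.toFormula
  | and γ δ => γ.toFormula ⊓ δ.toFormula
  | imp γ δ => γ.toFormula.imp δ.toFormula

/-- The sentence `∃ x_1 … ∃ x_k ∀ y_1 … ∀ y_{k'} ψ`. -/
noncomputable def Matr.sentence (ψ : Matr m ar k k') : (relLang m ar).Sentence :=
  FirstOrder.Language.Formula.iExs (Fin k)
    (FirstOrder.Language.Formula.iAlls (Fin k') ψ.toFormula)

/-- The sentence with matrix `ψ` has a model of exactly two elements. -/
def Matr.TwoElementSatisfiable (ψ : Matr m ar k k') : Prop :=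
  ∃ (M : Type) (_ : (relLang m ar).Structure M), Nat.card M = 2 ∧ M ⊨ ψ.sentence

/-- The list of occurrences of subformulas. -/
def Matr.subs : Matr m ar k k' → List (Matr m ar k k')
  | atom A => [atom A]
  | neg γ => neg γ :: γ.subs
  | or γ δ => or γ δ :: (γ.subs ++ δ.subs)
  | and γ δ => and γ δ :: (γ.subs ++ δ.subs)
  | imp γ δ => imp γ δ :: (γ.subs ++ δ.subs)

/-- `Ψ` lists the subformulas of `χ` without repetition, in an order along which some size `|·|` is
non-decreasing, where `|·|` is 1 on atoms and increases strictly from proper subformulas. -/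
def IsOrdering (χ : Matr m ar k k') (Ψ : List (Matr m ar k k')) : Prop :=
  Ψ.Nodup ∧ (∀ γ, γ ∈ Ψ ↔ γ ∈ χ.subs) ∧
    ∃ size : Matr m ar k k' → ℕ,
      (∀ A, size (.atom A) = 1) ∧
      (∀ γ δ, γ ∈ δ.subs → γ ≠ δ → size γ < size δ) ∧
      Ψ.Pairwise (fun γ δ => size γ ≤ size δ)

/-- The relational atoms of a list, in order. -/
def atomsOf (Ψ : List (Matr m ar k k')) : List (Atom m ar k k') :=
  Ψ.filterMap fun
    | .atom A => some A
    | _ => none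

/-- The largest arity. -/
def maxArity (ar : Fin m → ℕ) : ℕ := Finset.univ.sup ar

end FirstOrderPart

/-! ## Terms that manipulate conjunctions -/

/-- Left-nested conjunction `((φ_1 ∧ φ_2) ∧ …) ∧ φ_k`; the empty one is true. -/
def conj {N : Type} : List (JForm N) → JForm N
  | [] => .neg .bot
  | φ :: l => l.foldl .and φ

/-- Left-nested disjunction; the empty one is false. -/
def disj {N : Type} : List (JForm N) → JForm N
  | [] => .bot
  | φ :: l => l.foldl .or φ

/-- Left-nested iteration of a binary operation on terms, on a non-empty list. -/
def chainTerm (op : JTerm → JTerm → JTerm) : List JTerm → JTerm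
  | [] => .const 0
  | t :: l => l.foldl op t

/-- A choice of the basic terms; `cApp` is a constant. -/
structure BasicTerms where
  append : JTerm
  hypappend : JTerm
  appendconc : JTerm
  left : JTerm
  right : JTerm
  ident : JTerm
  tran : JTerm
  addhyp : JTerm
  replaceleft : JTerm
  replaceright : JTerm
  mphypoth : JTerm
  cApp : ℕ

open JForm in
/-- The basic terms justify the schemes they are meant for (for the agents 1 and 2, who use them)
and contain no justification variables; `cApp` justifies, for agent 2, the application axiom of
agent 1. -/
structure BasicTerms.Suitable (B : BasicTerms) (J : JLogic Agent) (CS : ConstSpec Agent) :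
    Prop where
  varFree : ∀ t ∈ [B.append, B.hypappend, B.appendconc, B.left, B.right, B.ident, B.tran,
    B.addhyp, B.replaceleft, B.replaceright, B.mphypoth], t.VarFree
  append : ∀ i ∈ [Agent.one, Agent.two], ∀ φ χ,
    J.Provable CS (box B.append i (imp φ (imp χ (and φ χ))))
  hypappend : ∀ i ∈ [Agent.one, Agent.two], ∀ φ χ,
    J.Provable CS (box B.hypappend i (imp (imp φ χ) (imp φ (and φ χ))))
  appendconc : ∀ i ∈ [Agent.one, Agent.two], ∀ φ χ θ,
    J.Provable CS (box B.appendconc i (imp (imp φ χ) (imp (imp φ θ) (imp φ (and χ θ)))))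
  left : ∀ i ∈ [Agent.one, Agent.two], ∀ φ χ,
    J.Provable CS (box B.left i (imp (and φ χ) φ))
  right : ∀ i ∈ [Agent.one, Agent.two], ∀ φ χ,
    J.Provable CS (box B.right i (imp (and φ χ) χ))
  ident : ∀ i ∈ [Agent.one, Agent.two], ∀ φ,
    J.Provable CS (box B.ident i (imp φ φ))
  tran : ∀ i ∈ [Agent.one, Agent.two], ∀ φ χ θ,
    J.Provable CS (box B.tran i (imp (imp φ χ) (imp (imp χ θ) (imp φ θ))))
  addhyp : ∀ i ∈ [Agent.one, Agent.two], ∀ φ χ,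
    J.Provable CS (box B.addhyp i (imp φ (imp χ φ)))
  replaceleft : ∀ i ∈ [Agent.one, Agent.two], ∀ φ φ' χ,
    J.Provable CS (box B.replaceleft i (imp (imp φ φ') (imp (and φ χ) (and φ' χ))))
  replaceright : ∀ i ∈ [Agent.one, Agent.two], ∀ φ χ χ',
    J.Provable CS (box B.replaceright i (imp (imp χ χ') (imp (and φ χ) (and φ χ'))))
  mphypoth : ∀ i ∈ [Agent.one, Agent.two], ∀ φ χ θ,
    J.Provable CS (box B.mphypoth i (imp (imp φ χ) (imp (imp φ (imp χ θ)) (imp φ θ))))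
  cApp : ∀ s t φ χ, CS B.cApp .two
    (imp (box s .one (imp φ χ)) (imp (box t .one φ) (box (.app s t) .one χ)))

/-- Application of justification terms, associating to the left. -/
infixl:70 " ⬝ₜ " => JTerm.app

namespace BasicTerms

variable (B : BasicTerms)

/-- The projection of a conjunction of `r` formulas to its conjunct number `x`
(`x = 0, …, r - 1`). -/
def proj : ℕ → ℕ → JTerm
  | 0, _ => B.ident
  | r + 1, x =>
    if x = r then (if r = 0 then B.ident else B.right)
    else B.tran ⬝ₜ B.left ⬝ₜ proj r x

/-- Replacement of conjunct number `x` (`x = 0, …, r - 1`) in a conjunction of `r` formulas. -/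
def replace : ℕ → ℕ → JTerm
  | 0, _ => B.ident
  | r + 1, x =>
    if x = r then (if r = 0 then B.ident else B.replaceright)
    else B.tran ⬝ₜ replace r x ⬝ₜ B.replaceleft

/-- `append` of a list of terms. -/
def appendAll (l : List JTerm) : JTerm := chainTerm (fun s t => B.append ⬝ₜ s ⬝ₜ t) l

end BasicTerms

/-! ## The reduction -/

section Reduction

variable {m : ℕ} {ar : Fin m → ℕ} {k k' : ℕ} (B : BasicTerms)

open JForm

/-- `p_a` or `¬ p_a`; these play the roles of `[p_a]^⊤` and `[p_a]^⊥`. -/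
def lit (a : ℕ) : Bool → JForm Agent
  | true => var (.p a)
  | false => neg (var (.p a))

def act : JForm Agent := var .active

/-- `var_a :_1 p_a` or `var_a :_1 ¬ p_a`. -/
def bitBox (a : ℕ) (b : Bool) : JForm Agent := box (.var (.bit a)) .one (lit a b)

/-- `rel_r :_1 [R_r]^△` -/
def relBox (r : ℕ) (b : Bool) : JForm Agent := box (.var (.rel r)) .one (var (.rel r b))

/-- `value_z :_1 [z]^△` -/
def valBox (z : ℕ) (b : Bool) : JForm Agent := box (.var (.value z)) .one (var (.z z b))

/-- `gather_r` -/
def gather (ar : Fin m → ℕ) (r : Fin m) : JTerm :=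
  B.appendAll ((List.range (ar r)).map (fun a => .var (.bit a)) ++ [.var (.rel r)])

/-- `T^{ρ₀}`, where `ρ₀ = k + k'`: the collection of the values of all first-order variables. -/
def allValues (ρ₀ : ℕ) : JTerm :=
  B.appendAll ((List.range ρ₀).map (fun z => .var (.value z)))

/-- The formula `Match`. -/
def matchForm (ar : Fin m → ℕ) (ρ₀ : ℕ) : JForm Agent :=
  conj ((List.range (maxArity ar)).flatMap fun l =>
    (List.range ρ₀).flatMap fun z =>
      [true, false].map fun b =>
        box (.var (.mat z l)) .one (imp (var (.z z b)) (imp (lit l b) (var (.ok l)))))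

/-- `tran · [tran · proj · match(z_b, p_b)] · replace` for the argument place `b` of an atom. -/
def matchStep (A : Atom m ar k k') (b : Fin (ar A.r)) : JTerm :=
  B.tran ⬝ₜ (B.tran ⬝ₜ B.proj (k + k') (A.args b) ⬝ₜ .var (.mat (A.args b) b))
    ⬝ₜ B.replace (ar A.r + 1) b

/-- The term `match_{a_r}^{R_r(z)}`. -/
def matchTerm (A : Atom m ar k k') : JTerm :=
  (List.finRange (ar A.r)).foldl (fun t b => B.mphypoth ⬝ₜ t ⬝ₜ matchStep B A b)
    (B.addhyp ⬝ₜ gather B ar A.r)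

/-- The term `T^!(match_{a_r}^{R_r(z)})`. -/
def matchBang (A : Atom m ar k k') : JTerm :=
  (List.finRange (ar A.r)).foldl
    (fun t b => .const B.cApp ⬝ₜ (.const B.cApp ⬝ₜ .bang B.mphypoth ⬝ₜ t)
      ⬝ₜ .bang (matchStep B A b))
    (.const B.cApp ⬝ₜ .bang B.addhyp ⬝ₜ .bang (gather B ar A.r))

/-- `[ψ_a]^△`, where `γ = ψ_a` in the list `Ψ`. -/
def subVar (Ψ : List (Matr m ar k k')) (γ : Matr m ar k k') (b : Bool) : JForm Agent :=
  var (.sub (Ψ.idxOf γ) b)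

/-- The conjunction of all `truth_a :_2 ([γ]^△ ∧ [δ]^△' → [ψ_a]^(f △ △'))`. -/
def evalBin (Ψ : List (Matr m ar k k')) (χ γ δ : Matr m ar k k') (f : Bool → Bool → Bool) :
    JForm Agent :=
  conj ([(true, true), (true, false), (false, true), (false, false)].map fun b =>
    box (.var (.truth (Ψ.idxOf χ))) .two
      (imp (and (subVar Ψ γ b.1) (subVar Ψ δ b.2)) (subVar Ψ χ (f b.1 b.2))))

/-- The formula `Eval_a` for `χ = ψ_a`. -/
def evalForm (Ψ : List (Matr m ar k k')) (χ : Matr m ar k k') : JForm Agent :=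
  match χ with
  | .atom A => conj ([true, false].map fun b =>
      box (.var (.truth (Ψ.idxOf χ))) .two
        (imp
          (box (matchTerm B A ⬝ₜ allValues B (k + k')) .one
            (conj ((List.range (ar A.r)).map (fun l => var (.ok l)) ++ [var (.rel A.r b)])))
          (subVar Ψ χ b)))
  | .neg γ => conj ([true, false].map fun b =>
      box (.var (.truth (Ψ.idxOf χ))) .two (imp (subVar Ψ γ b) (subVar Ψ χ (!b))))
  | .or γ δ => evalBin Ψ χ γ δ (fun b c => b || c)
  | .and γ δ => evalBin Ψ χ γ δ (fun b c => b && c)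
  | .imp γ δ => evalBin Ψ χ γ δ (fun b c => !b || c)

/-- The formula `Eval`. -/
def evalAll (Ψ : List (Matr m ar k k')) : JForm Agent := conj (Ψ.map (evalForm B Ψ))

/-- The last of the terms `gathrel_a`. -/
def gathrel (Ψ : List (Matr m ar k k')) : JTerm :=
  chainTerm (fun s t => B.appendconc ⬝ₜ s ⬝ₜ t)
    ((atomsOf Ψ).map fun A => .const B.cApp ⬝ₜ matchBang B A)

/-- The terms `T^{ρ₀ + a}`: the first `a` formulas of `Ψ` have been evaluated. For `a = 0` this is
`gathrel · !T^{ρ₀}`. -/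
def tTerm (Ψ : List (Matr m ar k k')) : ℕ → JTerm
  | 0 => gathrel B Ψ ⬝ₜ .bang (allValues B (k + k'))
  | a + 1 =>
    match Ψ[a]? with
    | none => tTerm Ψ a
    | some (.atom _) =>
        B.replace (atomsOf Ψ).length a ⬝ₜ .var (.truth a) ⬝ₜ tTerm Ψ a
    | some (.neg γ) =>
        B.hypappend ⬝ₜ (B.tran ⬝ₜ B.proj a (Ψ.idxOf γ) ⬝ₜ .var (.truth a)) ⬝ₜ tTerm Ψ a
    | some (.or γ δ) =>
        B.hypappend ⬝ₜ (B.tran ⬝ₜ (B.appendconc ⬝ₜ B.proj a (Ψ.idxOf γ) ⬝ₜ B.proj a (Ψ.idxOf δ))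
          ⬝ₜ .var (.truth a)) ⬝ₜ tTerm Ψ a
    | some (.and γ δ) =>
        B.hypappend ⬝ₜ (B.tran ⬝ₜ (B.appendconc ⬝ₜ B.proj a (Ψ.idxOf γ) ⬝ₜ B.proj a (Ψ.idxOf δ))
          ⬝ₜ .var (.truth a)) ⬝ₜ tTerm Ψ a
    | some (.imp γ δ) =>
        B.hypappend ⬝ₜ (B.tran ⬝ₜ (B.appendconc ⬝ₜ B.proj a (Ψ.idxOf γ) ⬝ₜ B.proj a (Ψ.idxOf δ))
          ⬝ₜ .var (.truth a)) ⬝ₜ tTerm Ψ a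

/-- The term `t = [right · T^l]`. -/
def finalTerm (Ψ : List (Matr m ar k k')) : JTerm := B.right ⬝ₜ tTerm B Ψ Ψ.length

/-- `ρ :_i χ` for the fixed justification variable `ρ`. -/
def rhoBox (i : Agent) (χ : JForm Agent) : JForm Agent := box (.var .rho) i χ

/-- `⋁_{b < a} var_b :_1 ¬ p_b` -/
def someZeroBelow (a : ℕ) : JForm Agent := disj ((List.range a).map fun b => bitBox b false)

/-- `⋀_{b < a} var_b :_1 p_b` (for `v = true`) and `⋀_{b < a} var_b :_1 ¬ p_b` (for `v = false`),
followed by `var_a :_1 p_a` or `var_a :_1 ¬ p_a`. -/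
def lowBits (a : ℕ) (v w : Bool) : List (JForm Agent) :=
  (List.range a).map (fun b => bitBox b v) ++ [bitBox a w]

/- In the next six formulas `n` is the largest arity `|α|`. -/

def startForm (n : ℕ) : JForm Agent :=
  and (neg act)
    (rhoBox .three (conj (act :: (List.range n).map fun a => bitBox a false)))

def forwardA (n : ℕ) : JForm Agent :=
  rhoBox .four (imp (and (someZeroBelow n) act) (rhoBox .three act))

def forwardB (n : ℕ) : JForm Agent :=
  rhoBox .four (conj ((List.range n).map fun a =>
    imp (conj (lowBits a true false ++ [act])) (rhoBox .three (conj (lowBits a false true)))))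

def forwardC (n : ℕ) : JForm Agent :=
  rhoBox .four (conj ((List.range n).map fun a =>
    imp (conj [someZeroBelow a, bitBox a false, act]) (rhoBox .three (bitBox a false))))

def forwardD (n : ℕ) : JForm Agent :=
  rhoBox .four (conj ((List.range n).map fun a =>
    imp (conj [someZeroBelow a, bitBox a true, act]) (rhoBox .three (bitBox a true))))

def endForm (n : ℕ) : JForm Agent :=
  rhoBox .four (imp (conj ((List.range n).map (fun a => bitBox a true) ++ [act]))
    (rhoBox .four (neg act)))

/-- `choice_R`, for the `m` relation symbols. -/
def choiceR (m : ℕ) : JForm Agent :=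
  rhoBox .four (imp act
    (conj ((List.range m).map fun r => or (relBox r true) (relBox r false))))

/-- `choice_V` -/
def choiceV (k k' : ℕ) : JForm Agent :=
  rhoBox .four (imp (neg act)
    (and
      (conj ((List.range k).map fun i => or (valBox i true) (valBox i false)))
      (conj ((List.range k').map fun j => and (valBox (k + j) true) (valBox (k + j) false)))))

/-- `test`; here `Ψ` orders the subformulas of `¬ ψ`. -/
def testForm (Ψ : List (Matr m ar k k')) (ψ : Matr m ar k k') : JForm Agent :=
  rhoBox .four (imp (neg act)
    (conj [matchForm ar (k + k'), evalAll B Ψ,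
      neg (box (finalTerm B Ψ) .two (subVar Ψ (.neg ψ) true))]))

/-- The justification formula `φ^J_FO` constructed from `φ = ∃ x_1 … ∃ x_k ∀ y_1 … ∀ y_{k'} ψ`. -/
def reductionForm (Ψ : List (Matr m ar k k')) (ψ : Matr m ar k k') : JForm Agent :=
  conj [startForm (maxArity ar), forwardA (maxArity ar), forwardB (maxArity ar),
    forwardC (maxArity ar), forwardD (maxArity ar), endForm (maxArity ar), choiceR m,
    choiceV k k', testForm B Ψ ψ]

end Reduction

/-- From `a` starts an `R₃`-chain of `2^n + 2` distinct states `s_{-1} = a, s_0, …, s_{2^n}` (shifted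
by one in `s`) such that `s_σ`, for `0 ≤ σ < 2^n`, is active, represents the tuple of the binary
digits of `σ` and holds a choice for each of the `m` relation symbols, while `s_{2^n}` is not
active. -/
def HasTupleChain {J : JLogic Agent} {CS : ConstSpec Agent} {W : Type} (M : FModel J CS W)
    (n m : ℕ) (a : W) : Prop :=
  ∃ s : ℕ → W, s 0 = a ∧ Set.InjOn s (Set.Iic (2 ^ n + 1)) ∧
    (∀ i ≤ 2 ^ n, M.R .three (s i) (s (i + 1))) ∧
    (∀ σ < 2 ^ n, M.Sat act (s (σ + 1)) ∧
      (∀ b < n, M.Sat (bitBox b (σ.testBit b)) (s (σ + 1))) ∧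
      (∀ r < m, M.Sat (relBox r true) (s (σ + 1)) ∨ M.Sat (relBox r false) (s (σ + 1)))) ∧
    ¬ M.Sat act (s (2 ^ n + 1))

/-!
The formula describes a binary counter: along any `R₃`-path the states hold the numbers
`0, …, 2 ^ n - 1`, read as `n`-tuples over a two-element set, and the counter is then switched off.
Evidence functions may let one state hold several numbers, but the step formulas act on each of
them (`FModel.rep_succ`), so a state that holds a number too large for its position would switch the
counter off too early. This makes the states distinct (`FModel.hasTupleChain`).

*From satisfiability to a two-element structure.* The value of a relation symbol at a tuple is
read off at the state that holds the tuple. Evidence of agent 1 that is gathered there is verified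
by agent 2, whose evidence persists along `R₃`, and hence is available at the last state. The
terms of the reduction act on conjunctions (`FModel.sat_proj`, `FModel.sat_replace`, …) and
evaluate first the atoms (`FModel.sat_matchBang`) and then all subformulas (`FModel.sat_tTerm`)
under any assignment that extends the chosen values of `x_1, …, x_k`. If `ψ` were false under one
of them, the final term would justify `[¬ψ]^⊤`, which `test` forbids
(`FModel.twoElementSatisfiable`).

*From a two-element structure to satisfiability.* In `chainModel` agents 1 and 2 have no
successors, so that only their evidence matters; it is the least evidence with the required basic
facts. What has to be shown is that `t^φ` does not justify `[¬ψ]^⊤`. No reading of the variables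
makes all basic evidence true, since it covers all tuples and both values of each `y_j`; but the
term draws on it sparingly. Two layers of one-point models make this precise, and the
variable-free terms need no analysis, because all they justify is valid in every model.
* A `world` fixes an assignment `v`, a tuple `σ` and the variables `j` at the argument places, and
  interprets the formulas that agent 1 justifies.
* A `judge` fixes only `v` and interprets the formulas that agent 2 justifies. In its eyes agent 1
  has the evidence `judgeEvidence`: a term that collects one tuple justifies what holds in the
  world of some tuple, a term that collects none what holds in the worlds of all tuples. Since
  `ok_l` is true in a world only if the tuple fits the assignment, the judge accepts `Eval`
  (`judge_accepts_eval`).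

The term `T^{ρ₀}` contains each `value_z` once, so that each of its uses selects one assignment
(`exists_assignment_of_mem_allValues`), and `!T^{ρ₀}` occurs once in `t^φ`. The other parts of
`t^φ` justify only what all judges accept. So some judge accepts whatever `t^φ` justifies
(`someAccept_tTerm`), and no judge of an admissible assignment accepts `[¬ψ]^⊤`.

*Existence of the basic terms.* Derivations of propositional schemes are internalized; a constant
for the most general instance of a scheme justifies all its instances, because the constant
specification is schematic (`exists_const_of_mem`, `exists_const_application`).
-/

/-! ### Truth of conjunctions and disjunctions; soundness -/

section Soundness

variable {N W : Type} {J : JLogic N} {CS : ConstSpec N}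

theorem conj_concat {l : List (JForm N)} (hl : l ≠ []) (φ : JForm N) :
    conj (l ++ [φ]) = .and (conj l) φ := by
  cases l with
  | nil => exact absurd rfl hl
  | cons χ l => simp [conj]

theorem disj_concat {l : List (JForm N)} (hl : l ≠ []) (φ : JForm N) :
    disj (l ++ [φ]) = .or (disj l) φ := by
  cases l with
  | nil => exact absurd rfl hl
  | cons χ l => simp [disj]

theorem FModel.sat_conj (M : FModel J CS W) (l : List (JForm N)) (a : W) :
    M.Sat (conj l) a ↔ ∀ φ ∈ l, M.Sat φ a := by
  induction l using List.reverseRecOn with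
  | nil => simp [conj, FModel.Sat]
  | append_singleton l φ ih =>
    rcases eq_or_ne l [] with rfl | hl
    · simp [conj]
    · rw [conj_concat hl]
      simp only [FModel.Sat, ih, List.mem_append, List.mem_singleton]
      grind

theorem FModel.sat_disj (M : FModel J CS W) (l : List (JForm N)) (a : W) :
    M.Sat (disj l) a ↔ ∃ φ ∈ l, M.Sat φ a := by
  induction l using List.reverseRecOn with
  | nil => simp [disj, FModel.Sat]
  | append_singleton l φ ih =>
    rcases eq_or_ne l [] with rfl | hl
    · simp [disj]
    · rw [disj_concat hl]
      simp only [FModel.Sat, ih, List.mem_append, List.mem_singleton]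
      grind

theorem FModel.sat_inst (M : FModel J CS W) (f : ℕ → JForm N) (σ : PScheme) (a : W) :
    M.Sat (σ.inst f) a ↔ σ.Eval (fun n => M.Sat (f n) a) := by
  induction σ <;> simp_all [PScheme.inst, PScheme.Eval, FModel.Sat]

theorem FModel.Sat.app {M : FModel J CS W} {s t : JTerm} {i : N} {φ χ : JForm N} {a : W}
    (hs : M.Sat (.box s i (.imp φ χ)) a) (ht : M.Sat (.box t i φ) a) :
    M.Sat (.box (.app s t) i χ) a :=
  ⟨M.application i s t φ χ ⟨hs.1, ht.1⟩, fun b hb => hs.2 b hb (ht.2 b hb)⟩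

theorem FModel.Sat.bang {M : FModel J CS W} {t : JTerm} {i j : N} (hij : J.ver i j)
    {φ : JForm N} {a : W} (h : M.Sat (.box t j φ) a) : M.Sat (.box (.bang t) i (.box t j φ)) a :=
  ⟨M.verification i j hij t φ h.1, fun b hb =>
    ⟨M.distribution j i hij t φ a b hb h.1, fun c hc => h.2 c (M.ver_trans i j hij a b c hb hc)⟩⟩

/-- Justified formulas persist along the relation of an agent that verifies. -/
theorem FModel.Sat.persist {M : FModel J CS W} {t : JTerm} {i j : N} (hij : J.ver i j)
    {φ : JForm N} {a b : W} (h : M.Sat (.box t j φ) a) (hab : M.R i a b) :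
    M.Sat (.box t j φ) b :=
  ⟨M.distribution j i hij t φ a b hab h.1, fun c hc => h.2 c (M.ver_trans i j hij a b c hab hc)⟩

theorem FModel.sat_of_isAxiom (hP : ∀ σ ∈ J.P, σ.Tautology) (M : FModel J CS W) {A : JForm N}
    (h : J.IsAxiom A) (a : W) : M.Sat A a := by
  obtain ⟨S, hS, hA⟩ := h
  cases S with
  | prop σ =>
    obtain ⟨f, rfl⟩ := hA
    exact (M.sat_inst f σ a).2 (hP σ hS _)
  | application i =>
    obtain ⟨s, t, φ, χ, rfl⟩ := hA
    exact fun h h' => h.app h'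
  | concatLeft i =>
    obtain ⟨s, t, φ, rfl⟩ := hA
    exact fun h => ⟨M.sum i s t φ (.inl h.1), h.2⟩
  | concatRight i =>
    obtain ⟨s, t, φ, rfl⟩ := hA
    exact fun h => ⟨M.sum i t s φ (.inr h.1), h.2⟩
  | factivity i =>
    obtain ⟨t, φ, rfl⟩ := hA
    exact fun h => h.2 a (M.reflexive i hS a)
  | consistency i =>
    obtain ⟨t, rfl⟩ := hA
    intro h
    obtain ⟨b, hb⟩ := M.serial i hS a
    exact h.2 b hb
  | conversion i j =>
    obtain ⟨t, φ, rfl⟩ := hA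
    exact fun h => ⟨M.conversion j i hS t φ h.1, fun b hb => h.2 b (M.sub_le j i hS a b hb)⟩
  | verification i j =>
    obtain ⟨t, φ, rfl⟩ := hA
    exact fun h => h.bang hS

theorem JLogic.Schematic.isAxiom (hS : J.Schematic CS) {c : ℕ} {i : N} {A : JForm N}
    (h : CS c i A) : J.IsAxiom A := by
  obtain ⟨T, hT, hA⟩ := hS c i
  obtain ⟨S, hST, hAS⟩ := (hA A).1 h
  exact ⟨S, hT S hST, hAS⟩

theorem FModel.sat_of_an (hP : ∀ σ ∈ J.P, σ.Tautology) (hS : J.Schematic CS)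
    (M : FModel J CS W) {t : JTerm} {i : N} {φ : JForm N} (h : AN CS t i φ) (a : W) :
    M.Sat φ a := by
  induction h generalizing a with
  | cs h => exact M.sat_of_isAxiom hP (hS.isAxiom h) a
  | bang h ih => exact ⟨by rw [M.an _ _ _ h]; trivial, fun b _ => ih b⟩

theorem FModel.sat_of_provable (hP : ∀ σ ∈ J.P, σ.Tautology) (hS : J.Schematic CS)
    (M : FModel J CS W) {φ : JForm N} (h : J.Provable CS φ) (a : W) : M.Sat φ a := by
  induction h with
  | ax h => exact M.sat_of_isAxiom hP h a
  | an h => exact ⟨by rw [M.an _ _ _ h]; trivial, fun b _ => M.sat_of_an hP hS h b⟩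
  | mp _ _ ih ih' => exact ih ih'

end Soundness

/-! ### Two-element structures -/

section TwoElement

variable {m : ℕ} {ar : Fin m → ℕ} {k k' : ℕ}

/-- Truth value of a matrix when the relation symbols are interpreted on `Bool` by `I` and the
variables by `v`. -/
def Matr.eval (I : (r : Fin m) → (Fin (ar r) → Bool) → Bool) (v : ℕ → Bool) :
    Matr m ar k k' → Bool
  | atom A => I A.r (fun b => v (A.args b))
  | neg γ => !γ.eval I v
  | or γ δ => γ.eval I v || δ.eval I v
  | and γ δ => γ.eval I v && δ.eval I v
  | imp γ δ => !γ.eval I v || δ.eval I v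

theorem Matr.realize_toFormula {M : Type} [(relLang m ar).Structure M] (e : M ≃ Bool)
    (I : (r : Fin m) → (Fin (ar r) → Bool) → Bool)
    (hI : ∀ r f, I r f = true ↔ FirstOrder.Language.Structure.RelMap (L := relLang m ar)
      (⟨r, rfl⟩ : {s : Fin m // ar s = ar r}) (fun b => e.symm (f b)))
    (u : (Empty ⊕ Fin k) ⊕ Fin k' → M) (v : ℕ → Bool)
    (hv : ∀ z : Fin (k + k'), v z = e (u (blockVar z))) (ψ : Matr m ar k k') :
    ψ.toFormula.Realize u ↔ ψ.eval I v = true := by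
  induction ψ with
  | atom A =>
    simp only [Matr.toFormula, Matr.eval, hI, hv]
    refine (FirstOrder.Language.Formula.realize_rel (L := relLang m ar)).trans ?_
    simp [FirstOrder.Language.Term.realize]
  | neg γ ih => simp [Matr.toFormula, Matr.eval, ih]
  | or γ δ ih ih' => simp [Matr.toFormula, Matr.eval, ih, ih']
  | and γ δ ih ih' => simp [Matr.toFormula, Matr.eval, ih, ih']
  | imp γ δ ih ih' =>
    simp only [Matr.toFormula, Matr.eval, FirstOrder.Language.Formula.realize_imp, ih, ih']
    cases γ.eval I v <;> simp

/-- Two-element satisfiability, with the universe fixed to be `Bool`. -/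
theorem Matr.twoElementSatisfiable_iff (ψ : Matr m ar k k') :
    ψ.TwoElementSatisfiable ↔ ∃ (I : (r : Fin m) → (Fin (ar r) → Bool) → Bool) (x : ℕ → Bool),
      ∀ v : ℕ → Bool, (∀ i < k, v i = x i) → ψ.eval I v = true := by
  classical
  constructor
  · rintro ⟨M, hM, hcard, hψ⟩
    have : Finite M := Nat.finite_of_card_ne_zero (by omega)
    have := Fintype.ofFinite M
    obtain ⟨e⟩ : Nonempty (M ≃ Bool) :=
      Fintype.card_eq.1 (by rw [← Nat.card_eq_fintype_card, hcard]; rfl)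
    simp only [Matr.sentence, FirstOrder.Language.Sentence.Realize] at hψ
    obtain ⟨x, hx⟩ := (FirstOrder.Language.Formula.realize_iExs (γ := Fin k)).1 hψ
    rw [FirstOrder.Language.Formula.realize_iAlls] at hx
    refine ⟨fun r f => decide (FirstOrder.Language.Structure.RelMap (L := relLang m ar)
      (⟨r, rfl⟩ : {s : Fin m // ar s = ar r}) (fun b => e.symm (f b))),
      fun i => if h : i < k then e (x ⟨i, h⟩) else true, fun v hv => ?_⟩
    refine (Matr.realize_toFormula e _ (by simp) _ v ?_ ψ).1 (hx fun j => e.symm (v (k + j)))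
    intro z
    induction z using Fin.addCases with
    | left i => simp [blockVar, hv i i.2]
    | right j => simp [blockVar]
  · rintro ⟨I, x, hx⟩
    let _ : (relLang m ar).Structure Bool :=
      { funMap := fun f => f.elim
        RelMap := fun {n} R f => I R.1 (fun b => f (Fin.cast R.2 b)) = true }
    refine ⟨Bool, inferInstance, by simp, ?_⟩
    simp only [Matr.sentence, FirstOrder.Language.Sentence.Realize]
    refine (FirstOrder.Language.Formula.realize_iExs (γ := Fin k)).2 ⟨fun i => x i, ?_⟩
    rw [FirstOrder.Language.Formula.realize_iAlls]
    intro y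
    refine (Matr.realize_toFormula (Equiv.refl Bool) I ?_ _
      (fun i => if h : i < k + k' then
        Sum.elim (Sum.elim default fun i : Fin k => x i) y (blockVar ⟨i, h⟩)
      else true) ?_ ψ).2 (hx _ ?_)
    · intro r f
      rfl
    · intro z
      induction z using Fin.addCases with
      | left i => simp [blockVar, Fin.is_lt, show (i : ℕ) < k + k' by omega, Fin.addCases]
      | right j => simp [blockVar, Fin.addCases]
    · intro i hi
      have : (⟨i, by omega⟩ : Fin (k + k')) = Fin.castAdd k' ⟨i, hi⟩ := rfl
      simp only [show i < k + k' by omega, dite_true, this, blockVar, Fin.addCases_left]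
      rfl

end TwoElement

/-! ### The binary counter -/

theorem Nat.testBit_succ_eq (σ b : ℕ) :
    (σ + 1).testBit b = (σ.testBit b ^^ decide (∀ c < b, σ.testBit c = true)) := by
  induction b generalizing σ with
  | zero => simp [Nat.testBit_zero]; grind
  | succ b ih =>
    rw [Nat.testBit_add_one, Nat.testBit_add_one]
    rcases Nat.even_or_odd' σ with ⟨τ, rfl | rfl⟩
    · rw [show (2 * τ + 1) / 2 = 2 * τ / 2 by omega]
      have : ¬ ∀ c < b + 1, (2 * τ).testBit c = true := fun h => by
        have := h 0 (by omega); simp [Nat.testBit_zero] at this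
      rw [decide_eq_false this, Bool.xor_false]
    · rw [show (2 * τ + 1 + 1) / 2 = τ + 1 by omega, show (2 * τ + 1) / 2 = τ by omega, ih]
      congr 2
      apply propext
      rw [Nat.forall_lt_succ_left]
      simp [Nat.testBit_add_one, Nat.testBit_zero, show (2 * τ + 1) / 2 = τ by omega]

theorem Nat.add_one_lt_two_pow_of_testBit {n σ b : ℕ} (hσ : σ < 2 ^ n) (hb : b < n)
    (h : σ.testBit b = false) : σ + 1 < 2 ^ n := by
  rcases Nat.lt_or_ge (σ + 1) (2 ^ n) with h' | h'
  · exact h'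
  · have : σ = 2 ^ n - 1 := by omega
    rw [this, Nat.testBit_two_pow_sub_one] at h
    simp [hb] at h

theorem Nat.exists_testBit_eq_false {n σ : ℕ} (hσ : σ + 1 < 2 ^ n) :
    ∃ b < n, σ.testBit b = false := by
  by_contra! h
  have : σ = 2 ^ n - 1 := by
    refine Nat.eq_of_testBit_eq fun i => ?_
    rw [Nat.testBit_two_pow_sub_one]
    rcases Nat.lt_or_ge i n with hi | hi
    · simpa [hi] using h i hi
    · rw [Nat.testBit_lt_two_pow (lt_of_lt_of_le (by omega) (Nat.pow_le_pow_right (by omega) hi))]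
      simp; omega
  omega

/-! ### The chain of states that encode tuples -/

section Chain

variable {P : Set PScheme} {CS : ConstSpec Agent} {W : Type} {M : FModel (JH P) CS W} {m n : ℕ}

theorem FModel.three_le_four {a b : W} (h : M.R .three a b) : M.R .four a b :=
  M.sub_le .three .four ⟨rfl, rfl⟩ a b h

theorem FModel.four_trans {a b c : W} (h : M.R .four a b) (h' : M.R .four b c) :
    M.R .four a c :=
  M.ver_trans .four .four (.inr (.inr ⟨rfl, rfl⟩)) a b c h h'

/-- The state `a` holds the binary digits of `σ`. -/
def FModel.Rep (M : FModel (JH P) CS W) (n : ℕ) (a : W) (σ : ℕ) : Prop :=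
  ∀ b < n, M.Sat (bitBox b (σ.testBit b)) a

theorem FModel.sat_someZeroBelow {a c : ℕ} {s : W} (hc : c < a)
    (h : M.Sat (bitBox c false) s) : M.Sat (someZeroBelow a) s :=
  (M.sat_disj _ s).2 ⟨_, List.mem_map.2 ⟨c, List.mem_range.2 hc, rfl⟩, h⟩

theorem FModel.sat_conj_lowBits {a : ℕ} {v w : Bool} {s : W} :
    M.Sat (conj (lowBits a v w)) s ↔ (∀ b < a, M.Sat (bitBox b v) s) ∧ M.Sat (bitBox a w) s := by
  rw [M.sat_conj]
  simp only [lowBits, List.mem_append, List.mem_map, List.mem_range, List.mem_singleton]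
  grind

/-- The counter steps: a successor of an active state that holds `σ` is active and holds `σ + 1`. -/
theorem FModel.rep_succ {a s t : W} (hA : M.Sat (forwardA n) a) (hB : M.Sat (forwardB n) a)
    (hC : M.Sat (forwardC n) a) (hD : M.Sat (forwardD n) a) (has : M.R .four a s)
    (hst : M.R .three s t) (hs : M.Sat act s) {σ : ℕ} (hσ : σ + 1 < 2 ^ n) (hr : M.Rep n s σ) :
    M.Sat act t ∧ M.Rep n t (σ + 1) := by
  have hz : ∀ c < n, σ.testBit c = false → M.Sat (bitBox c false) s :=
    fun c hc h => by simpa [h] using hr c hc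
  have ho : ∀ c < n, σ.testBit c = true → M.Sat (bitBox c true) s :=
    fun c hc h => by simpa [h] using hr c hc
  constructor
  · obtain ⟨b, hb, hb'⟩ := Nat.exists_testBit_eq_false hσ
    exact (hA.2 s has ⟨M.sat_someZeroBelow hb (hz b hb hb'), hs⟩).2 t hst
  · intro b hb
    rw [Nat.testBit_succ_eq]
    by_cases hlow : ∀ c < b, σ.testBit c = true
    · rw [decide_eq_true hlow]
      cases hσb : σ.testBit b with
      | false =>
        have := (M.sat_conj _ s).1 (hB.2 s has) _
          (List.mem_map.2 ⟨b, List.mem_range.2 hb, rfl⟩)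
        refine (M.sat_conj_lowBits.1 ((this ?_).2 t hst)).2
        rw [conj_concat (by simp [lowBits])]
        exact ⟨M.sat_conj_lowBits.2 ⟨fun c hc => ho c (by omega) (hlow c hc), hz b hb hσb⟩, hs⟩
      | true =>
        -- bit `b` falls to zero with the carry that stops at the lowest zero bit `d`
        have hd := Nat.exists_testBit_eq_false hσ
        classical
        obtain ⟨hdn, hd0⟩ := Nat.find_spec hd
        have hmin : ∀ c < Nat.find hd, σ.testBit c = true := fun c hc => by
          have := Nat.find_min hd hc
          by_contra h'
          exact this ⟨by omega, by simpa using h'⟩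
        have hbd : b < Nat.find hd := by
          rcases lt_trichotomy b (Nat.find hd) with h | h | h
          · exact h
          · rw [h, hd0] at hσb; cases hσb
          · rw [hlow _ h] at hd0; cases hd0
        have := (M.sat_conj _ s).1 (hB.2 s has) _
          (List.mem_map.2 ⟨Nat.find hd, List.mem_range.2 hdn, rfl⟩)
        refine (M.sat_conj_lowBits.1 ((this ?_).2 t hst)).1 b hbd
        rw [conj_concat (by simp [lowBits])]
        exact ⟨M.sat_conj_lowBits.2 ⟨fun c hc => ho c (by omega) (hmin c hc), hz _ hdn hd0⟩, hs⟩
    · rw [decide_eq_false hlow, Bool.xor_false]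
      push Not at hlow
      obtain ⟨c, hcb, hc⟩ := hlow
      have hzero : M.Sat (someZeroBelow b) s :=
        M.sat_someZeroBelow hcb (hz c (by omega) (by simpa using hc))
      cases hσb : σ.testBit b with
      | false =>
        exact ((M.sat_conj _ s).1 (hC.2 s has) _ (List.mem_map.2 ⟨b, List.mem_range.2 hb, rfl⟩)
          ⟨⟨hzero, hz b hb hσb⟩, hs⟩).2 t hst
      | true =>
        exact ((M.sat_conj _ s).1 (hD.2 s has) _ (List.mem_map.2 ⟨b, List.mem_range.2 hb, rfl⟩)
          ⟨⟨hzero, ho b hb hσb⟩, hs⟩).2 t hst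

/-- After the last tuple the counter is switched off for good. -/
theorem FModel.not_act_of_rep_last {a s t : W} (hE : M.Sat (endForm n) a) (has : M.R .four a s)
    (hst : M.R .four s t) (hs : M.Sat act s) {σ : ℕ} (hσ : σ + 1 = 2 ^ n) (hr : M.Rep n s σ) :
    ¬ M.Sat act t := by
  refine (hE.2 s has ?_).2 t hst
  rw [M.sat_conj]
  simp only [List.mem_append, List.mem_map, List.mem_range, List.mem_singleton]
  rintro φ (⟨b, hb, rfl⟩ | rfl)
  · have := hr b hb
    rwa [show σ = 2 ^ n - 1 by omega, Nat.testBit_two_pow_sub_one, decide_eq_true hb] at this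
  · exact hs

/-- The states of the chain are distinct although evidence functions may let a state hold several
tuples at once: the largest number held by a state increases along the chain, and it must not reach
its maximum too early, because the counter is then switched off. -/
theorem FModel.hasTupleChain {a : W} (h0 : M.Sat (startForm n) a) (hA : M.Sat (forwardA n) a)
    (hB : M.Sat (forwardB n) a) (hC : M.Sat (forwardC n) a) (hD : M.Sat (forwardD n) a)
    (hE : M.Sat (endForm n) a) (hR : M.Sat (choiceR m) a) : HasTupleChain M n m a := by
  choose f hf using fun b => M.serial .three rfl b
  set s : ℕ → W := fun i => f^[i] a with hs
  have hstep : ∀ i, M.R .three (s i) (s (i + 1)) := fun i => by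
    simp only [hs, Function.iterate_succ_apply']
    exact hf _
  have hlt : ∀ i j, i < j → M.R .four (s i) (s j) := by
    intro i j hij
    induction j, hij using Nat.le_induction with
    | base => exact M.three_le_four (hstep i)
    | succ j _ ih => exact M.four_trans ih (M.three_le_four (hstep j))
  have hpos : 0 < 2 ^ n := by positivity
  have hrep : ∀ σ < 2 ^ n, M.Sat act (s (σ + 1)) ∧ M.Rep n (s (σ + 1)) σ := by
    intro σ hσ
    induction σ with
    | zero =>
      have := (M.sat_conj _ _).1 (h0.2.2 (s 1) (hstep 0))
      refine ⟨this _ (by simp), fun b hb => this _ ?_⟩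
      simpa using .inr ⟨b, hb, rfl⟩
    | succ σ ih =>
      obtain ⟨h1, h2⟩ := ih (by omega)
      exact M.rep_succ hA hB hC hD (hlt 0 _ (by omega)) (hstep _) h1 hσ h2
  have hlast : ∀ i, 2 ^ n < i → ¬ M.Sat act (s i) := by
    intro i hi
    obtain ⟨h1, h2⟩ := hrep (2 ^ n - 1) (by omega)
    exact M.not_act_of_rep_last hE (hlt 0 _ (by omega)) (hlt _ i (by omega)) h1 (by omega) h2
  have hmax : ∀ d i τ, i < 2 ^ n → τ + d + 1 = 2 ^ n → M.Rep n (s (i + 1)) τ → τ ≤ i := by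
    intro d
    induction d with
    | zero =>
      intro i τ hi hτ hr
      by_contra hlt'
      exact M.not_act_of_rep_last hE (hlt 0 _ (by omega)) (M.three_le_four (hstep (i + 1)))
        (hrep i hi).1 (by omega) hr (hrep (i + 1) (by omega)).1
    | succ d ih =>
      intro i τ hi hτ hr
      by_contra hlt'
      have := (M.rep_succ hA hB hC hD (hlt 0 _ (by omega)) (hstep (i + 1)) (hrep i hi).1
        (by omega) hr).2
      have := ih (i + 1) (τ + 1) (by omega) (by omega) this
      omega
  have hne : ∀ i j, i < j → j ≤ 2 ^ n + 1 → s i ≠ s j := by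
    intro i j hij hj heq
    rcases Nat.eq_zero_or_pos i with rfl | hi
    · rcases Nat.lt_or_ge j (2 ^ n + 1) with hj' | hj'
      · refine h0.1 (?_ : M.Sat act (s 0))
        rw [heq, show j = j - 1 + 1 by omega]
        exact (hrep (j - 1) (by omega)).1
      · obtain rfl : j = 2 ^ n + 1 := by omega
        obtain ⟨h1, h2⟩ := hrep (2 ^ n - 1) (by omega)
        refine M.not_act_of_rep_last hE (hlt 0 _ (by omega)) (t := s 1) ?_ h1 (by omega) h2
          (hrep 0 hpos).1
        refine M.four_trans (hlt _ (2 ^ n + 1) (by omega)) ?_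
        rw [← heq]
        exact hlt 0 1 (by omega)
    · obtain ⟨i, rfl⟩ : ∃ i', i = i' + 1 := ⟨i - 1, by omega⟩
      obtain ⟨j, rfl⟩ : ∃ j', j = j' + 1 := ⟨j - 1, by omega⟩
      rcases Nat.lt_or_ge j (2 ^ n) with hj' | hj'
      · have := hmax (2 ^ n - 1 - j) i j (by omega) (by omega) (heq ▸ (hrep j hj').2)
        omega
      · exact hlast (j + 1) (by omega) (heq ▸ (hrep i (by omega)).1)
  refine ⟨s, rfl, ?_, fun i _ => hstep i, fun σ hσ => ⟨(hrep σ hσ).1, (hrep σ hσ).2, ?_⟩,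
    hlast _ (by omega)⟩
  · intro i hi j hj hij
    simp only [Set.mem_Iic] at hi hj
    rcases lt_trichotomy i j with h | h | h
    · exact absurd hij (hne i j h hj)
    · exact h
    · exact absurd hij.symm (hne j i h hi)
  · intro r hr
    exact (M.sat_conj _ _).1 (hR.2 _ (hlt 0 _ (by omega)) (hrep σ hσ).1) _
      (List.mem_map.2 ⟨r, List.mem_range.2 hr, rfl⟩)

end Chain

/-! ### Terms that operate on conjunctions -/

section Combinators

variable {P : Set PScheme} {CS : ConstSpec Agent} {W : Type} {B : BasicTerms} {i : Agent} {a : W}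

open JForm

theorem FModel.sat_proj (M : FModel (JH P) CS W) (hP : ∀ σ ∈ P, σ.Tautology)
    (hS : (JH P).Schematic CS) (hB : B.Suitable (JH P) CS) (hi : i ∈ [Agent.one, Agent.two])
    (l : List (JForm Agent)) (x : ℕ) (φ : JForm Agent) (hx : l[x]? = some φ) :
    M.Sat (box (B.proj l.length x) i (imp (conj l) φ)) a := by
  have sound {θ} (h : (JH P).Provable CS θ) : M.Sat θ a := M.sat_of_provable hP hS h a
  induction l using List.reverseRecOn with
  | nil => simp at hx
  | append_singleton l χ ih =>
    rw [List.length_append, List.length_singleton, BasicTerms.proj]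
    rcases eq_or_ne x l.length with rfl | hne
    · obtain rfl : χ = φ := by simpa using hx
      rw [if_pos rfl]
      rcases eq_or_ne l [] with rfl | hl
      · exact sound (hB.ident i hi _)
      · rw [if_neg (by simpa using hl), conj_concat hl]
        exact sound (hB.right i hi _ _)
    · have hlt : x < l.length := by
        have := (List.getElem?_eq_some_iff.1 hx).1
        simp at this
        omega
      have hl : l ≠ [] := by rintro rfl; simp at hlt
      rw [if_neg hne, conj_concat hl]
      rw [List.getElem?_append_left hlt] at hx
      exact ((sound (hB.tran i hi _ _ _)).app (sound (hB.left i hi _ _))).app (ih hx)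

theorem FModel.sat_replace (M : FModel (JH P) CS W) (hP : ∀ σ ∈ P, σ.Tautology)
    (hS : (JH P).Schematic CS) (hB : B.Suitable (JH P) CS) (hi : i ∈ [Agent.one, Agent.two])
    (l : List (JForm Agent)) (x : ℕ) (φ φ' : JForm Agent) (hx : l[x]? = some φ) :
    M.Sat (box (B.replace l.length x) i (imp (imp φ φ') (imp (conj l) (conj (l.set x φ'))))) a := by
  have sound {θ} (h : (JH P).Provable CS θ) : M.Sat θ a := M.sat_of_provable hP hS h a
  induction l using List.reverseRecOn with
  | nil => simp at hx
  | append_singleton l χ ih =>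
    rw [List.length_append, List.length_singleton, BasicTerms.replace]
    rcases eq_or_ne x l.length with rfl | hne
    · obtain rfl : χ = φ := by simpa using hx
      rw [if_pos rfl, List.set_append_right _ _ le_rfl, Nat.sub_self, List.set_cons_zero]
      rcases eq_or_ne l [] with rfl | hl
      · exact sound (hB.ident i hi _)
      · rw [if_neg (by simpa using hl), conj_concat hl, conj_concat hl]
        exact sound (hB.replaceright i hi _ _ _)
    · have hlt : x < l.length := by
        have := (List.getElem?_eq_some_iff.1 hx).1
        simp at this
        omega
      have hl : l ≠ [] := by rintro rfl; simp at hlt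
      rw [if_neg hne, List.set_append_left _ _ hlt, conj_concat hl,
        conj_concat (by simpa using hl)]
      rw [List.getElem?_append_left hlt] at hx
      exact ((sound (hB.tran i hi _ _ _)).app (ih hx)).app (sound (hB.replaceleft i hi _ _ _))

theorem chainTerm_concat (op : JTerm → JTerm → JTerm) {l : List JTerm} (hl : l ≠ []) (t : JTerm) :
    chainTerm op (l ++ [t]) = op (chainTerm op l) t := by
  cases l with
  | nil => exact absurd rfl hl
  | cons s l => simp [chainTerm]

theorem FModel.sat_appendAll {α : Type} (M : FModel (JH P) CS W) (hP : ∀ σ ∈ P, σ.Tautology)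
    (hS : (JH P).Schematic CS) (hB : B.Suitable (JH P) CS) (hi : i ∈ [Agent.one, Agent.two])
    (l : List α) (hl : l ≠ []) (t : α → JTerm) (φ : α → JForm Agent)
    (h : ∀ x ∈ l, M.Sat (box (t x) i (φ x)) a) :
    M.Sat (box (B.appendAll (l.map t)) i (conj (l.map φ))) a := by
  induction l using List.reverseRecOn with
  | nil => exact absurd rfl hl
  | append_singleton l x ih =>
    rcases eq_or_ne l [] with rfl | hl
    · exact h x (by simp)
    · rw [List.map_append, List.map_append, BasicTerms.appendAll, List.map_singleton,
        chainTerm_concat _ (by simpa using hl), List.map_singleton, conj_concat (by simpa using hl)]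
      exact ((M.sat_of_provable hP hS (hB.append i hi _ _) a).app
        (ih hl fun y hy => h y (by simp [hy]))).app (h x (by simp))

theorem FModel.sat_chain_appendconc {α : Type} (M : FModel (JH P) CS W)
    (hP : ∀ σ ∈ P, σ.Tautology) (hS : (JH P).Schematic CS) (hB : B.Suitable (JH P) CS)
    (hi : i ∈ [Agent.one, Agent.two]) (l : List α) (hl : l ≠ []) (ζ : JForm Agent)
    (t : α → JTerm) (φ : α → JForm Agent) (h : ∀ x ∈ l, M.Sat (box (t x) i (imp ζ (φ x))) a) :
    M.Sat (box (chainTerm (fun s t => B.appendconc ⬝ₜ s ⬝ₜ t) (l.map t)) i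
      (imp ζ (conj (l.map φ)))) a := by
  induction l using List.reverseRecOn with
  | nil => exact absurd rfl hl
  | append_singleton l x ih =>
    rcases eq_or_ne l [] with rfl | hl
    · exact h x (by simp)
    · rw [List.map_append, List.map_append, List.map_singleton,
        chainTerm_concat _ (by simpa using hl), List.map_singleton, conj_concat (by simpa using hl)]
      exact ((M.sat_of_provable hP hS (hB.appendconc i hi _ _ _) a).app
        (ih hl fun y hy => h y (by simp [hy]))).app (h x (by simp))

end Combinators

/-- Induction along a fold over `0, …, N - 1`. -/
theorem List.foldl_finRange_induction {α : Type*} {N : ℕ} (f : α → Fin N → α) (p : ℕ → α → Prop)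
    (x : α) (h0 : p 0 x) (hs : ∀ (b : Fin N) (y : α), p b y → p (b + 1) (f y b)) :
    p N ((List.finRange N).foldl f x) := by
  induction N with
  | zero => simpa using h0
  | succ N ih =>
    rw [List.finRange_succ_last, List.foldl_append, List.foldl_map]
    have := ih (fun y b => f y b.castSucc) (fun b y hy => hs b.castSucc y hy)
    exact hs (Fin.last N) _ this

/-! ### Evaluation of atoms -/

section Atoms

variable {P : Set PScheme} {CS : ConstSpec Agent} {W : Type} {B : BasicTerms} {a : W}
  {m : ℕ} {ar : Fin m → ℕ} {k k' : ℕ}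

open JForm

/-- The conjunction of `[z]^{v z}` for all variables `z`. -/
def valuesForm (ρ₀ : ℕ) (v : ℕ → Bool) : JForm Agent :=
  conj ((List.range ρ₀).map fun z => var (.z z (v z)))

/-- The conjuncts that describe a tuple `σ` of which the first `b` entries have been matched, and
the value `e` of the relation `R_r` at the tuple. -/
def matchedList (N r b : ℕ) (σ : ℕ → Bool) (e : Bool) : List (JForm Agent) :=
  (List.range N).map (fun l => if l < b then var (.ok l) else lit l (σ l)) ++ [var (.rel r e)]

theorem matchedList_set {N r b : ℕ} (hb : b < N) (σ : ℕ → Bool) (e : Bool) :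
    (matchedList N r b σ e).set b (var (.ok b)) = matchedList N r (b + 1) σ e := by
  rw [matchedList, List.set_append_left _ _ (by simpa using hb), matchedList]
  congr 1
  apply List.ext_getElem
  · simp
  · intro c h1 h2
    simp only [List.getElem_set, List.getElem_map, List.getElem_range]
    grind

theorem FModel.sat_gather (M : FModel (JH P) CS W) (hP : ∀ σ ∈ P, σ.Tautology)
    (hS : (JH P).Schematic CS) (hB : B.Suitable (JH P) CS) (r : Fin m) (σ : ℕ → Bool) (e : Bool)
    (hσ : ∀ b < ar r, M.Sat (bitBox b (σ b)) a) (he : M.Sat (relBox r e) a) :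
    M.Sat (box (gather B ar r) .one (conj (matchedList (ar r) r 0 σ e))) a := by
  have := M.sat_appendAll (a := a) hP hS hB (i := .one) (by simp)
    ((List.range (ar r)).map some ++ [none]) (by simp)
    (fun o => o.elim (.var (.rel r)) fun b => .var (.bit b))
    (fun o => o.elim (var (.rel r e)) fun b => lit b (σ b)) (by
      simp only [List.mem_append, List.mem_map, List.mem_range, List.mem_singleton]
      rintro o (⟨b, hb, rfl⟩ | rfl)
      · exact hσ b hb
      · exact he)
  simpa [gather, matchedList, Function.comp_def] using this

theorem FModel.sat_matchStep (M : FModel (JH P) CS W) (hP : ∀ σ ∈ P, σ.Tautology)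
    (hS : (JH P).Schematic CS) (hB : B.Suitable (JH P) CS) (A : Atom m ar k k')
    (hM : M.Sat (matchForm ar (k + k')) a) (v σ : ℕ → Bool) (e : Bool)
    (hσ : ∀ b : Fin (ar A.r), σ b = v (A.args b)) (b : Fin (ar A.r)) :
    M.Sat (box (matchStep B A b) .one (imp (valuesForm (k + k') v)
      (imp (conj (matchedList (ar A.r) A.r b σ e))
        (conj (matchedList (ar A.r) A.r (b + 1) σ e))))) a := by
  have h1 : Agent.one ∈ [Agent.one, Agent.two] := by simp
  have sound {θ} (h : (JH P).Provable CS θ) : M.Sat θ a := M.sat_of_provable hP hS h a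
  have hproj := M.sat_proj (a := a) hP hS hB h1
    ((List.range (k + k')).map fun z => var (.z z (v z))) (A.args b)
    (var (.z (A.args b) (v (A.args b)))) (by simp [(A.args b).2])
  have hmat : M.Sat (box (.var (.mat (A.args b) b)) .one (imp (var (.z (A.args b) (σ b)))
      (imp (lit b (σ b)) (var (.ok b))))) a := by
    refine (M.sat_conj _ a).1 hM _ ?_
    have : (b : ℕ) < maxArity ar := lt_of_lt_of_le b.2 (Finset.le_sup (Finset.mem_univ A.r))
    simp only [List.mem_flatMap, List.mem_range, List.mem_map]
    exact ⟨b, this, A.args b, (A.args b).2, σ b, by cases σ b <;> simp, rfl⟩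
  have hrep := M.sat_replace (a := a) hP hS hB h1 (matchedList (ar A.r) A.r b σ e) b
    (lit b (σ b)) (var (.ok b)) (by
      rw [matchedList, List.getElem?_append_left (by simp)]
      simp)
  rw [matchedList_set b.2] at hrep
  rw [List.length_map, List.length_range, ← hσ b] at hproj
  rw [show (matchedList (ar A.r) A.r b σ e).length = ar A.r + 1 by simp [matchedList]] at hrep
  exact ((sound (hB.tran .one h1 _ _ _)).app
    (((sound (hB.tran .one h1 _ _ _)).app hproj).app hmat)).app hrep

/-- The steps of `matchTerm` and of `matchBang` in parallel. -/
theorem matchTerm_matchBang (B : BasicTerms) (A : Atom m ar k k') (p : ℕ → JTerm → JTerm → Prop)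
    (h0 : p 0 (B.addhyp ⬝ₜ gather B ar A.r)
      (.const B.cApp ⬝ₜ .bang B.addhyp ⬝ₜ .bang (gather B ar A.r)))
    (hs : ∀ (b : Fin (ar A.r)) s t, p b s t → p (b + 1) (B.mphypoth ⬝ₜ s ⬝ₜ matchStep B A b)
      (.const B.cApp ⬝ₜ (.const B.cApp ⬝ₜ .bang B.mphypoth ⬝ₜ t) ⬝ₜ .bang (matchStep B A b))) :
    p (ar A.r) (matchTerm B A) (matchBang B A) := by
  have := List.foldl_finRange_induction
    (fun (q : JTerm × JTerm) (b : Fin (ar A.r)) => ((B.mphypoth ⬝ₜ q.1 ⬝ₜ matchStep B A b),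
      (.const B.cApp ⬝ₜ (.const B.cApp ⬝ₜ .bang B.mphypoth ⬝ₜ q.2) ⬝ₜ .bang (matchStep B A b))))
    (fun b q => p b q.1 q.2) (_, _) h0 (fun b q hq => hs b _ _ hq)
  have key : ∀ (l : List (Fin (ar A.r))) (s t : JTerm),
      l.foldl (fun (q : JTerm × JTerm) (b : Fin (ar A.r)) =>
        ((B.mphypoth ⬝ₜ q.1 ⬝ₜ matchStep B A b),
          (.const B.cApp ⬝ₜ (.const B.cApp ⬝ₜ .bang B.mphypoth ⬝ₜ q.2)
            ⬝ₜ .bang (matchStep B A b)))) (s, t) =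
      (l.foldl (fun s b => B.mphypoth ⬝ₜ s ⬝ₜ matchStep B A b) s,
        l.foldl (fun t b => .const B.cApp ⬝ₜ (.const B.cApp ⬝ₜ .bang B.mphypoth ⬝ₜ t)
          ⬝ₜ .bang (matchStep B A b)) t) := by
    intro l
    induction l with
    | nil => intro s t; rfl
    | cons b l ih => intro s t; simp only [List.foldl_cons, ih]
  rw [key] at this
  exact this

theorem ver_two_one : (JH P).ver .two .one := .inl ⟨rfl, rfl⟩

theorem ver_three_two : (JH P).ver .three .two := .inr (.inl ⟨rfl, rfl⟩)

/-- Agent 2 can apply the application axiom of agent 1. -/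
theorem FModel.Sat.cApp {M : FModel (JH P) CS W} (hP : ∀ σ ∈ P, σ.Tautology)
    (hS : (JH P).Schematic CS) (hB : B.Suitable (JH P) CS) {s t s' t' : JTerm}
    {φ χ : JForm Agent} (hs : M.Sat (box s' .two (box s .one (imp φ χ))) a)
    (ht : M.Sat (box t' .two (box t .one φ)) a) :
    M.Sat (box (.const B.cApp ⬝ₜ s' ⬝ₜ t') .two (box (s ⬝ₜ t) .one χ)) a :=
  ((M.sat_of_provable hP hS (.an (.cs (hB.cApp s t φ χ))) a).app hs).app ht

theorem FModel.sat_matchBang (M : FModel (JH P) CS W) (hP : ∀ σ ∈ P, σ.Tautology)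
    (hS : (JH P).Schematic CS) (hB : B.Suitable (JH P) CS) (A : Atom m ar k k')
    (hM : M.Sat (matchForm ar (k + k')) a) (v σ : ℕ → Bool) (e : Bool)
    (hσ : ∀ b : Fin (ar A.r), σ b = v (A.args b))
    (hg : M.Sat (box (.bang (gather B ar A.r)) .two
      (box (gather B ar A.r) .one (conj (matchedList (ar A.r) A.r 0 σ e)))) a) :
    M.Sat (box (matchBang B A) .two (box (matchTerm B A) .one
      (imp (valuesForm (k + k') v) (conj (matchedList (ar A.r) A.r (ar A.r) σ e))))) a := by
  have h1 : Agent.one ∈ [Agent.one, Agent.two] := by simp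
  have sound {θ} (h : (JH P).Provable CS θ) : M.Sat θ a := M.sat_of_provable hP hS h a
  refine matchTerm_matchBang B A (fun b s t => M.Sat (box t .two (box s .one
      (imp (valuesForm (k + k') v) (conj (matchedList (ar A.r) A.r b σ e))))) a) ?_ ?_
  · exact ((sound (hB.addhyp .one h1 _ _)).bang ver_two_one).cApp hP hS hB hg
  · intro b s t h
    exact (((sound (hB.mphypoth .one h1 _ _ _)).bang ver_two_one).cApp hP hS hB h).cApp hP hS hB
      ((M.sat_matchStep hP hS hB A hM v σ e hσ b).bang ver_two_one)

end Atoms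

/-! ### Orderings of the subformulas -/

section Orderings

variable {m : ℕ} {ar : Fin m → ℕ} {k k' : ℕ}

theorem Matr.mem_subs_self (γ : Matr m ar k k') : γ ∈ γ.subs := by
  cases γ <;> simp [Matr.subs]

theorem Matr.subs_trans {γ δ χ : Matr m ar k k'} (h : γ ∈ δ.subs) (h' : δ ∈ χ.subs) :
    γ ∈ χ.subs := by
  induction χ with
  | atom A => simp_all [Matr.subs]
  | neg χ ih => simp only [Matr.subs, List.mem_cons] at h' ⊢; grind [Matr.subs]
  | or χ θ ih ih' =>
    simp only [Matr.subs, List.mem_cons, List.mem_append] at h' ⊢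
    grind [Matr.subs]
  | and χ θ ih ih' =>
    simp only [Matr.subs, List.mem_cons, List.mem_append] at h' ⊢
    grind [Matr.subs]
  | imp χ θ ih ih' =>
    simp only [Matr.subs, List.mem_cons, List.mem_append] at h' ⊢
    grind [Matr.subs]

theorem Matr.exists_atom_mem_subs (γ : Matr m ar k k') : ∃ A, Matr.atom A ∈ γ.subs := by
  induction γ with
  | atom A => exact ⟨A, by simp [Matr.subs]⟩
  | neg χ ih => obtain ⟨A, h⟩ := ih; exact ⟨A, by simp [Matr.subs, h]⟩
  | or χ θ ih _ => obtain ⟨A, h⟩ := ih; exact ⟨A, by simp [Matr.subs, h]⟩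
  | and χ θ ih _ => obtain ⟨A, h⟩ := ih; exact ⟨A, by simp [Matr.subs, h]⟩
  | imp χ θ ih _ => obtain ⟨A, h⟩ := ih; exact ⟨A, by simp [Matr.subs, h]⟩

/-- The number of symbols of a matrix, with an atom counted as one symbol. -/
def Matr.symbols : Matr m ar k k' → ℕ
  | atom _ => 1
  | neg γ => γ.symbols + 1
  | or γ δ => γ.symbols + δ.symbols + 1
  | and γ δ => γ.symbols + δ.symbols + 1
  | imp γ δ => γ.symbols + δ.symbols + 1

theorem Matr.eq_or_symbols_lt {γ δ : Matr m ar k k'} (h : γ ∈ δ.subs) :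
    γ = δ ∨ γ.symbols < δ.symbols := by
  induction δ with
  | atom A => simp_all [Matr.subs]
  | neg χ ih => simp only [Matr.subs, List.mem_cons] at h; grind [Matr.symbols]
  | or χ θ ih ih' =>
    simp only [Matr.subs, List.mem_cons, List.mem_append] at h
    grind [Matr.symbols]
  | and χ θ ih ih' =>
    simp only [Matr.subs, List.mem_cons, List.mem_append] at h
    grind [Matr.symbols]
  | imp χ θ ih ih' =>
    simp only [Matr.subs, List.mem_cons, List.mem_append] at h
    grind [Matr.symbols]

theorem exists_isOrdering (χ : Matr m ar k k') : ∃ Ψ, IsOrdering χ Ψ := by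
  let r : Matr m ar k k' → Matr m ar k k' → Prop := fun γ δ => γ.symbols ≤ δ.symbols
  have : Std.Total r := ⟨fun γ δ => le_total γ.symbols δ.symbols⟩
  have : IsTrans _ r := ⟨fun _ _ _ h h' => Nat.le_trans h h'⟩
  have : DecidableRel r := fun γ δ => inferInstanceAs (Decidable (γ.symbols ≤ δ.symbols))
  refine ⟨χ.subs.dedup.insertionSort r, ?_, ?_, Matr.symbols, fun A => rfl, ?_,
    List.pairwise_insertionSort r _⟩
  · exact (List.perm_insertionSort r _).nodup_iff.2 (List.nodup_dedup _)
  · intro γ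
    rw [(List.perm_insertionSort r _).mem_iff, List.mem_dedup]
  · intro γ δ h hne
    exact (Matr.eq_or_symbols_lt h).resolve_left hne

theorem IsOrdering.mem {χ : Matr m ar k k'} {Ψ : List (Matr m ar k k')} (h : IsOrdering χ Ψ)
    {γ δ : Matr m ar k k'} (hδ : δ ∈ Ψ) (hγ : γ ∈ δ.subs) : γ ∈ Ψ :=
  (h.2.1 γ).2 (Matr.subs_trans hγ ((h.2.1 δ).1 hδ))

theorem IsOrdering.idxOf_lt {χ : Matr m ar k k'} {Ψ : List (Matr m ar k k')}
    (h : IsOrdering χ Ψ) {γ δ : Matr m ar k k'} (hδ : δ ∈ Ψ) (hγ : γ ∈ δ.subs) (hne : γ ≠ δ) :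
    Ψ.idxOf γ < Ψ.idxOf δ := by
  have hγΨ := h.mem hδ hγ
  obtain ⟨size, -, hlt, hp⟩ := h.2.2
  have h1 := List.idxOf_lt_length_of_mem hγΨ
  have h2 := List.idxOf_lt_length_of_mem hδ
  rcases lt_trichotomy (Ψ.idxOf γ) (Ψ.idxOf δ) with h' | h' | h'
  · exact h'
  · exact absurd ((List.idxOf_inj hγΨ).1 h') hne
  · have := List.pairwise_iff_getElem.1 hp _ _ h2 h1 h'
    rw [List.getElem_idxOf, List.getElem_idxOf] at this
    exact absurd (hlt γ δ hγ hne) (by omega)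

theorem IsOrdering.eq_concat {χ : Matr m ar k k'} {Ψ : List (Matr m ar k k')}
    (h : IsOrdering χ Ψ) : ∃ Ψ', Ψ = Ψ' ++ [χ] := by
  have hχ : χ ∈ Ψ := (h.2.1 χ).2 χ.mem_subs_self
  obtain ⟨size, -, hlt, hp⟩ := h.2.2
  induction Ψ using List.reverseRecOn with
  | nil => simp at hχ
  | append_singleton Ψ δ _ =>
    refine ⟨Ψ, ?_⟩
    by_contra hne
    have hδ : δ ≠ χ := fun h' => hne (by rw [h'])
    have h1 := hlt δ χ ((h.2.1 δ).1 (by simp)) hδ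
    have h2 : χ ∈ Ψ := by
      simp only [List.mem_append, List.mem_singleton] at hχ
      exact hχ.resolve_right (Ne.symm hδ)
    have := (List.pairwise_append.1 hp).2.2 χ h2 δ (by simp)
    omega

/-- The atoms form an initial segment. -/
theorem IsOrdering.eq_atomsOf_append {χ : Matr m ar k k'} {Ψ : List (Matr m ar k k')}
    (h : IsOrdering χ Ψ) :
    ∃ Θ, Ψ = (atomsOf Ψ).map .atom ++ Θ ∧ ∀ γ ∈ Θ, ∀ A, γ ≠ .atom A := by
  obtain ⟨size, hone, hlt, hp⟩ := h.2.2
  have hle : ∀ (γ : Matr m ar k k'), (∀ A, γ ≠ .atom A) → 1 < size γ := by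
    intro γ hγ
    obtain ⟨A, hA⟩ := γ.exists_atom_mem_subs
    rw [← hone A]
    exact hlt _ _ hA (Ne.symm (hγ A))
  clear h
  induction Ψ with
  | nil => exact ⟨[], by simp [atomsOf]⟩
  | cons γ Ψ ih =>
    rw [List.pairwise_cons] at hp
    obtain ⟨Θ, h1, h2⟩ := ih hp.2
    by_cases hγ : ∃ A, γ = .atom A
    · obtain ⟨A, rfl⟩ := hγ
      exact ⟨Θ, by simpa [atomsOf] using h1, h2⟩
    · push Not at hγ
      refine ⟨γ :: Ψ, ?_, ?_⟩
      · have : atomsOf (γ :: Ψ) = [] := by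
          rw [atomsOf, List.filterMap_eq_nil_iff]
          intro δ hδ
          have hs : 1 < size δ := by
            rcases List.mem_cons.1 hδ with rfl | hδ
            · exact hle _ hγ
            · exact lt_of_lt_of_le (hle _ hγ) (hp.1 δ hδ)
          cases δ with
          | atom A => rw [hone] at hs; omega
          | _ => rfl
        rw [this]; rfl
      · intro δ hδ A
        rintro rfl
        rcases List.mem_cons.1 hδ with h | hδ
        · exact hγ A h.symm
        · have := hp.1 _ hδ
          have := hle _ hγ
          rw [hone] at *
          omega

theorem mem_atomsOf {Ψ : List (Matr m ar k k')} {A : Atom m ar k k'} :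
    A ∈ atomsOf Ψ ↔ .atom A ∈ Ψ := by
  rw [atomsOf, List.mem_filterMap]
  constructor
  · rintro ⟨γ, hγ, h⟩
    cases γ <;> simp_all
  · exact fun h => ⟨_, h, rfl⟩

theorem IsOrdering.atomsOf_ne_nil {χ : Matr m ar k k'} {Ψ : List (Matr m ar k k')}
    (h : IsOrdering χ Ψ) : atomsOf Ψ ≠ [] := by
  obtain ⟨A, hA⟩ := χ.exists_atom_mem_subs
  exact List.ne_nil_of_mem (mem_atomsOf.2 ((h.2.1 _).2 hA))

end Orderings

/-! ### Satisfiability of the reduction yields a two-element structure -/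

section Evaluation

variable {P : Set PScheme} {CS : ConstSpec Agent} {W : Type} {B : BasicTerms} {a : W}
  {m : ℕ} {ar : Fin m → ℕ} {k k' : ℕ}

open JForm

theorem conj_matchedList_self (N r : ℕ) (σ : ℕ → Bool) (e : Bool) :
    conj (matchedList N r N σ e) =
      conj ((List.range N).map (fun l => var (.ok l)) ++ [var (.rel r e)]) := by
  rw [matchedList]
  congr 2
  exact List.map_congr_left fun l hl => if_pos (List.mem_range.1 hl)

/-- The formula `[match · T] :_1 (ok_1 ∧ … ∧ [R_r]^e)`, which yields the value `e` of an atom. -/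
def atomForm (B : BasicTerms) (A : Atom m ar k k') (e : Bool) : JForm Agent :=
  box (matchTerm B A ⬝ₜ allValues B (k + k')) .one
    (conj ((List.range (ar A.r)).map (fun l => var (.ok l)) ++ [var (.rel A.r e)]))

theorem FModel.sat_gathrel (M : FModel (JH P) CS W) (hP : ∀ σ ∈ P, σ.Tautology)
    (hS : (JH P).Schematic CS) (hB : B.Suitable (JH P) CS) (Ψ : List (Matr m ar k k'))
    (hΨ : atomsOf Ψ ≠ [])
    (hM : M.Sat (matchForm ar (k + k')) a) (v : ℕ → Bool) (e : Atom m ar k k' → Bool)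
    (hg : ∀ A : Atom m ar k k', ∃ σ : ℕ → Bool, (∀ b : Fin (ar A.r), σ b = v (A.args b)) ∧
      M.Sat (box (.bang (gather B ar A.r)) .two
        (box (gather B ar A.r) .one (conj (matchedList (ar A.r) A.r 0 σ (e A))))) a) :
    M.Sat (box (gathrel B Ψ) .two
      (imp (box (allValues B (k + k')) .one (valuesForm (k + k') v))
        (conj ((atomsOf Ψ).map fun A => atomForm B A (e A))))) a := by
  refine M.sat_chain_appendconc hP hS hB (by simp) _ hΨ _ _ _ fun A _ => ?_
  obtain ⟨σ, hσ, h⟩ := hg A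
  have := M.sat_matchBang hP hS hB A hM v σ (e A) hσ h
  rw [conj_matchedList_self] at this
  exact (M.sat_of_provable hP hS (.an (.cs (hB.cApp _ _ _ _))) a).app this

/-- The formulas justified by `tTerm B Ψ a`: the first `a` formulas of `Ψ` have got their value, the
remaining atoms have not. -/
def stageList (B : BasicTerms) (Ψ : List (Matr m ar k k')) (ev : Matr m ar k k' → Bool) (a : ℕ) :
    List (JForm Agent) :=
  (Ψ.take a).map (fun γ => subVar Ψ γ (ev γ)) ++
    ((atomsOf Ψ).drop a).map (fun A => atomForm B A (ev (.atom A)))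

theorem FModel.sat_tTerm (M : FModel (JH P) CS W) (hP : ∀ σ ∈ P, σ.Tautology)
    (hS : (JH P).Schematic CS) (hB : B.Suitable (JH P) CS) {χ : Matr m ar k k'}
    {Ψ : List (Matr m ar k k')} (hΨ : IsOrdering χ Ψ) (hE : M.Sat (evalAll B Ψ) a)
    (I : (r : Fin m) → (Fin (ar r) → Bool) → Bool) (v : ℕ → Bool)
    (h0 : M.Sat (box (tTerm B Ψ 0) .two
      (conj ((atomsOf Ψ).map fun A => atomForm B A (Matr.eval I v (.atom A))))) a)
    {c : ℕ} (hc : c ≤ Ψ.length) :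
    M.Sat (box (tTerm B Ψ c) .two (conj (stageList B Ψ (Matr.eval I v) c))) a := by
  have h2 : Agent.two ∈ [Agent.one, Agent.two] := by simp
  have sound {θ} (h : (JH P).Provable CS θ) : M.Sat θ a := M.sat_of_provable hP hS h a
  obtain ⟨Θ, hΨΘ, hΘ⟩ := hΨ.eq_atomsOf_append
  have hq : 0 < (atomsOf Ψ).length := List.length_pos_of_ne_nil hΨ.atomsOf_ne_nil
  induction c with
  | zero => simpa [stageList] using h0
  | succ c ih =>
    have ih := ih (by omega)
    have hget : Ψ[c]? = some Ψ[c] := List.getElem?_eq_getElem (by omega)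
    have hidx : Ψ.idxOf Ψ[c] = c := hΨ.1.idxOf_getElem c (by omega)
    have hEc := (M.sat_conj _ a).1 hE _ (List.mem_map.2 ⟨Ψ[c], List.getElem_mem _, rfl⟩)
    rcases Nat.lt_or_ge c (atomsOf Ψ).length with hcq | hcq
    · have hA : Ψ[c] = .atom (atomsOf Ψ)[c] := by
        have : Ψ[c]? = ((atomsOf Ψ)[c]?).map .atom := by
          conv_lhs => rw [hΨΘ]
          rw [List.getElem?_append_left (by simpa using hcq), List.getElem?_map]
        rw [hget, List.getElem?_eq_getElem hcq] at this
        exact Option.some.inj this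
      have hatom : (stageList B Ψ (Matr.eval I v) c)[c]? =
          some (atomForm B (atomsOf Ψ)[c] (Ψ[c].eval I v)) := by
        rw [stageList, List.getElem?_append_right (by simp), List.length_map, List.length_take,
          min_eq_left (by omega), Nat.sub_self, List.getElem?_map, List.getElem?_drop,
          Nat.add_zero, List.getElem?_eq_getElem hcq, hA]
        rfl
      have hset : (stageList B Ψ (Matr.eval I v) c).set c (subVar Ψ Ψ[c] (Ψ[c].eval I v)) =
          stageList B Ψ (Matr.eval I v) (c + 1) := by
        rw [stageList, List.set_append_right _ _ (by simp), List.length_map, List.length_take,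
          min_eq_left (by omega), Nat.sub_self, List.drop_eq_getElem_cons hcq, List.map_cons,
          List.set_cons_zero, stageList, List.take_add_one, hget, Option.toList_some,
          List.map_append, List.map_singleton, List.append_assoc, List.singleton_append]
      have hrep := M.sat_replace (a := a) hP hS hB h2 _ c _ (subVar Ψ Ψ[c] (Ψ[c].eval I v)) hatom
      rw [hset, show (stageList B Ψ (Matr.eval I v) c).length = (atomsOf Ψ).length by
        simp [stageList]; omega] at hrep
      rw [tTerm, hget]
      generalize (atomsOf Ψ)[c] = A at *
      rw [hA] at hEc hidx hrep ⊢
      rw [evalForm] at hEc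
      have htruth := (M.sat_conj _ a).1 hEc _ (List.mem_map.2
        ⟨(Matr.atom A).eval I v, by cases (Matr.atom A).eval I v <;> simp, rfl⟩)
      rw [hidx] at htruth
      exact (hrep.app htruth).app ih
    · have hst : stageList B Ψ (Matr.eval I v) c =
          (Ψ.take c).map (fun γ => subVar Ψ γ (γ.eval I v)) := by
        simp [stageList, List.drop_eq_nil_of_le hcq]
      have hst' : stageList B Ψ (Matr.eval I v) (c + 1) =
          stageList B Ψ (Matr.eval I v) c ++ [subVar Ψ Ψ[c] (Ψ[c].eval I v)] := by
        rw [hst, stageList, List.drop_eq_nil_of_le (by omega), List.take_add_one, hget,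
          Option.toList_some, List.map_append, List.map_singleton, List.map_nil, List.append_nil]
      have hlen : (stageList B Ψ (Matr.eval I v) c).length = c := by
        rw [hst]; simp; omega
      have hne : stageList B Ψ (Matr.eval I v) c ≠ [] := by
        rintro h
        rw [h] at hlen
        simp at hlen
        omega
      have hproj : ∀ γ ∈ Ψ[c].subs, γ.symbols < Ψ[c].symbols →
          M.Sat (box (B.proj c (Ψ.idxOf γ)) .two
            (imp (conj (stageList B Ψ (Matr.eval I v) c)) (subVar Ψ γ (γ.eval I v)))) a := by
        intro γ hγ hγne
        have hlt := hΨ.idxOf_lt (List.getElem_mem _) hγ fun h => hγne.ne (congrArg _ h)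
        rw [hidx] at hlt
        have := M.sat_proj (a := a) hP hS hB h2 (stageList B Ψ (Matr.eval I v) c) (Ψ.idxOf γ)
          (subVar Ψ γ (γ.eval I v)) (by
            rw [hst, List.getElem?_map, List.getElem?_take_of_lt hlt,
              List.getElem?_eq_getElem (by omega), List.getElem_idxOf]
            rfl)
        rwa [hlen] at this
      rw [hst', conj_concat hne]
      have hbin : ∀ γ δ, γ ∈ Ψ[c].subs → γ.symbols < Ψ[c].symbols → δ ∈ Ψ[c].subs →
          δ.symbols < Ψ[c].symbols →
          ∀ f : Bool → Bool → Bool, M.Sat (evalBin Ψ Ψ[c] γ δ f) a →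
          Ψ[c].eval I v = f (γ.eval I v) (δ.eval I v) →
          M.Sat (box (B.hypappend ⬝ₜ (B.tran ⬝ₜ (B.appendconc ⬝ₜ B.proj c (Ψ.idxOf γ)
            ⬝ₜ B.proj c (Ψ.idxOf δ)) ⬝ₜ .var (.truth c)) ⬝ₜ tTerm B Ψ c) .two
            (and (conj (stageList B Ψ (Matr.eval I v) c)) (subVar Ψ Ψ[c] (Ψ[c].eval I v)))) a := by
        intro γ δ hγ hγne hδ hδne f hf heq
        have htruth := (M.sat_conj _ a).1 hf _ (List.mem_map.2
          ⟨(γ.eval I v, δ.eval I v), by cases γ.eval I v <;> cases δ.eval I v <;> simp, rfl⟩)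
        rw [hidx, ← heq] at htruth
        exact ((sound (hB.hypappend .two h2 _ _)).app (((sound (hB.tran .two h2 _ _ _)).app
          (((sound (hB.appendconc .two h2 _ _ _)).app (hproj γ hγ hγne)).app
            (hproj δ hδ hδne))).app htruth)).app ih
      have hnot : ∀ A, Ψ[c] ≠ .atom A := by
        refine hΘ _ ?_
        have : Ψ[c]? = Θ[c - (atomsOf Ψ).length]? := by
          conv_lhs => rw [hΨΘ]
          rw [List.getElem?_append_right (by simpa using hcq), List.length_map]
        exact List.mem_of_getElem? (this.symm.trans hget)
      rw [tTerm, hget]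
      generalize Ψ[c] = χ' at *
      cases χ' with
      | atom A => exact absurd rfl (hnot A)
      | neg γ =>
        rw [evalForm] at hEc
        have htruth := (M.sat_conj _ a).1 hEc _ (List.mem_map.2
          ⟨γ.eval I v, by cases γ.eval I v <;> simp, rfl⟩)
        rw [hidx] at htruth
        exact ((sound (hB.hypappend .two h2 _ _)).app (((sound (hB.tran .two h2 _ _ _)).app
          (hproj γ (by simp [Matr.subs, Matr.mem_subs_self]) (by simp [Matr.symbols]))).app
            htruth)).app ih
      | or γ δ =>
        exact hbin γ δ (by simp [Matr.subs, Matr.mem_subs_self])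
          (by simp only [Matr.symbols]; omega)
          (by simp [Matr.subs, Matr.mem_subs_self]) (by simp only [Matr.symbols]; omega)
          (fun b c => b || c) hEc rfl
      | and γ δ =>
        exact hbin γ δ (by simp [Matr.subs, Matr.mem_subs_self])
          (by simp only [Matr.symbols]; omega)
          (by simp [Matr.subs, Matr.mem_subs_self]) (by simp only [Matr.symbols]; omega)
          (fun b c => b && c) hEc rfl
      | imp γ δ =>
        exact hbin γ δ (by simp [Matr.subs, Matr.mem_subs_self])
          (by simp only [Matr.symbols]; omega)
          (by simp [Matr.subs, Matr.mem_subs_self]) (by simp only [Matr.symbols]; omega)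
          (fun b c => !b || c) hEc rfl

/-- The value of a relation symbol at a tuple is read off at the state of the chain that holds the
tuple, and the values of `x_1, …, x_k` at the last state. The evidence available at the last state
evaluates the matrix accordingly, so that it cannot be false. -/
theorem FModel.twoElementSatisfiable (M : FModel (JH P) CS W) (hP : ∀ σ ∈ P, σ.Tautology)
    (hS : (JH P).Schematic CS) (hB : B.Suitable (JH P) CS) (hk : 0 < k + k')
    {ψ : Matr m ar k k'} {Ψ : List (Matr m ar k k')} (hΨ : IsOrdering (.neg ψ) Ψ)
    (hch : HasTupleChain M (maxArity ar) m a) (hV : M.Sat (choiceV k k') a)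
    (hT : M.Sat (testForm B Ψ ψ) a) : ψ.TwoElementSatisfiable := by
  classical
  rw [Matr.twoElementSatisfiable_iff]
  obtain ⟨s, rfl, -, hstep, htup, hlast⟩ := hch
  have har : ∀ r, ar r ≤ maxArity ar := fun r => Finset.le_sup (Finset.mem_univ r)
  generalize maxArity ar = n at *
  obtain ⟨t, ht⟩ : ∃ t, t = s (2 ^ n + 1) := ⟨_, rfl⟩
  rw [← ht] at hlast
  have hpos : 0 < 2 ^ n := by positivity
  have hlt : ∀ j ≤ 2 ^ n + 1, 0 < j → M.R .four (s 0) (s j) := by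
    intro j hj hj0
    induction j, hj0 using Nat.le_induction with
    | base => exact M.three_le_four (hstep 0 (by omega))
    | succ j hj0 ih => exact M.four_trans (ih (by omega)) (M.three_le_four (hstep j (by omega)))
  have hpersist : ∀ i ≤ 2 ^ n + 1, ∀ (u : JTerm) (φ : JForm Agent),
      M.Sat (box u .two φ) (s i) → M.Sat (box u .two φ) t := by
    intro i hi u φ h
    induction hi using Nat.decreasingInduction with
    | self => rwa [ht]
    | of_succ i hi ih => exact ih (h.persist ver_three_two (hstep i (by omega)))
  have hV' := hV.2 t (ht ▸ hlt _ le_rfl (by omega)) hlast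
  have hT' := (M.sat_conj _ t).1 (hT.2 t (ht ▸ hlt _ le_rfl (by omega)) hlast)
  -- `code r f` is the number whose binary digits are the tuple `f`, filled up with zeros
  obtain ⟨code, hcodelt, hcodebit⟩ : ∃ code : (r : Fin m) → (Fin (ar r) → Bool) → ℕ,
      (∀ r f, code r f < 2 ^ n) ∧ ∀ r f (b : Fin (ar r)), (code r f).testBit b = f b := by
    refine ⟨fun r f => Nat.ofBits (fun b : Fin n => if h : (b : ℕ) < ar r then f ⟨b, h⟩ else false),
      fun r f => Nat.ofBits_lt_two_pow _, fun r f b => ?_⟩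
    simp only
    rw [Nat.testBit_ofBits_lt _ _ (lt_of_lt_of_le b.2 (har r))]
    simp
  obtain ⟨I, hI⟩ : ∃ I : (r : Fin m) → (Fin (ar r) → Bool) → Bool,
      ∀ r f, I r f = decide (M.Sat (relBox r true) (s (code r f + 1))) := ⟨_, fun _ _ => rfl⟩
  refine ⟨I, fun i => decide (M.Sat (valBox i true) t), fun v hv => ?_⟩
  simp only at hv
  by_contra hψ
  have hval : ∀ z ∈ List.range (k + k'), M.Sat (valBox z (v z)) t := by
    intro z hz
    rw [List.mem_range] at hz
    rcases Nat.lt_or_ge z k with hzk | hzk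
    · have := (M.sat_conj _ t).1 hV'.1 _ (List.mem_map.2 ⟨z, List.mem_range.2 hzk, rfl⟩)
      rw [hv z hzk]
      by_cases h : M.Sat (valBox z true) t
      · rwa [decide_eq_true h]
      · rw [decide_eq_false h]
        exact this.resolve_left h
    · have := (M.sat_conj _ t).1 hV'.2 _
        (List.mem_map.2 ⟨z - k, List.mem_range.2 (by omega), rfl⟩)
      rw [show k + (z - k) = z by omega] at this
      cases v z
      · exact this.2
      · exact this.1
  have hall := M.sat_appendAll hP hS hB (by simp : Agent.one ∈ [Agent.one, Agent.two])
    (List.range (k + k')) (by simpa using by omega) _ _ hval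
  have hgath := M.sat_gathrel (a := t) hP hS hB Ψ hΨ.atomsOf_ne_nil (hT' _ (by simp)) v
    (fun A => Matr.eval I v (.atom A)) (by
      intro A
      have hval := hI A.r fun b => v (A.args b)
      have hσ := hcodelt A.r fun b => v (A.args b)
      have hbit := hcodebit A.r fun b => v (A.args b)
      generalize (code A.r fun b => v (A.args b)) = σ at *
      obtain ⟨h1, h2, h3⟩ := htup σ hσ
      refine ⟨σ.testBit, hbit, ?_⟩
      refine hpersist (σ + 1) (by omega) _ _
        (FModel.Sat.bang ver_two_one ?_)
      refine M.sat_gather hP hS hB A.r _ _ (fun b hb => h2 b (lt_of_lt_of_le hb (har _))) ?_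
      rw [Matr.eval, hval]
      by_cases h : M.Sat (relBox A.r true) (s (σ + 1))
      · rwa [decide_eq_true h]
      · rw [decide_eq_false h]
        exact (h3 A.r A.r.2).resolve_left h)
  obtain ⟨Ψ', hΨ'⟩ := hΨ.eq_concat
  have hne : Ψ' ≠ [] := by
    rintro rfl
    have : ψ ∈ Ψ := (hΨ.2.1 ψ).2 (by simp [Matr.subs, ψ.mem_subs_self])
    rw [hΨ'] at this
    have := congrArg Matr.symbols (List.mem_singleton.1 this)
    simp [Matr.symbols] at this
  have hfin := M.sat_tTerm (a := t) hP hS hB hΨ (hT' _ (by simp)) I v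
    (hgath.app (hall.bang ver_two_one)) (le_refl Ψ.length)
  have hlist : stageList B Ψ (Matr.eval I v) Ψ.length =
      Ψ'.map (fun γ => subVar Ψ γ (γ.eval I v)) ++ [subVar Ψ (.neg ψ) true] := by
    have hle : (atomsOf Ψ).length ≤ Ψ.length := List.length_filterMap_le _ _
    rw [stageList, List.take_length, List.drop_eq_nil_of_le hle]
    conv_lhs => rw [List.map_nil, List.append_nil]; arg 2; rw [hΨ']
    have hneg : (Matr.neg ψ).eval I v = true := by simpa [Matr.eval] using hψ
    rw [List.map_append, List.map_singleton, hneg]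
  rw [hlist, conj_concat (by simpa using hne)] at hfin
  have hnot := hT' (.neg (box (finalTerm B Ψ) .two (subVar Ψ (.neg ψ) true))) (by simp)
  exact hnot ((M.sat_of_provable hP hS (hB.right .two (by simp) _ _) t).app hfin)

end Evaluation

/-! ### Evidence generated by the structure of terms -/

section Evidence

variable {CS : ConstSpec Agent}

/-- All justification variables of a term satisfy `p`. -/
def JTerm.AllVars (p : JVar → Prop) : JTerm → Prop
  | .const _ => True
  | .var x => p x
  | .sum s t => s.AllVars p ∧ t.AllVars p
  | .app s t => s.AllVars p ∧ t.AllVars p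
  | .bang t => t.AllVars p

theorem JTerm.VarFree.allVars {t : JTerm} (h : t.VarFree) (p : JVar → Prop) : t.AllVars p := by
  induction t with
  | const c => trivial
  | var x => exact h.elim
  | sum s t ih ih' => exact ⟨ih h.1, ih' h.2⟩
  | app s t ih ih' => exact ⟨ih h.1, ih' h.2⟩
  | bang t ih => exact ih h

/-- The least evidence of agent `i` that contains `bv x` for each variable `x` and, besides Axiom
Necessitation, `bb t` for each term `!t`. All closure conditions lead from terms to compound terms,
so that it can be computed by recursion. -/
def evidence (CS : ConstSpec Agent) (i : Agent) (bv : JVar → Set (JForm Agent))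
    (bb : JTerm → Set (JForm Agent)) : JTerm → Set (JForm Agent)
  | .const c => {φ | CS c i φ}
  | .var x => bv x
  | .sum s t => evidence CS i bv bb s ∪ evidence CS i bv bb t
  | .app s t => {χ | ∃ φ, .imp φ χ ∈ evidence CS i bv bb s ∧ φ ∈ evidence CS i bv bb t}
  | .bang t => {φ | AN CS (.bang t) i φ} ∪ bb t

theorem AN.mem_evidence {i : Agent} {bv : JVar → Set (JForm Agent)}
    {bb : JTerm → Set (JForm Agent)} {t : JTerm} {φ : JForm Agent} (h : AN CS t i φ) :
    φ ∈ evidence CS i bv bb t := by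
  cases h with
  | cs h => exact h
  | bang h => exact .inl (.bang h)

theorem FModel.sat_of_mem_evidence {P : Set PScheme} (hP : ∀ σ ∈ P, σ.Tautology)
    (hS : (JH P).Schematic CS) {W : Type} (M : FModel (JH P) CS W) (a : W) {i : Agent}
    {bv : JVar → Set (JForm Agent)} {t : JTerm}
    (ht : t.AllVars fun x => ∀ φ ∈ bv x, M.Sat φ a) {φ : JForm Agent}
    (h : φ ∈ evidence CS i bv (fun _ => ∅) t) : M.Sat φ a := by
  induction t generalizing φ with
  | const c => exact M.sat_of_isAxiom hP (hS.isAxiom h) a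
  | var x => exact ht φ h
  | sum s t ih ih' => exact h.elim (ih ht.1) (ih' ht.2)
  | app s t ih ih' =>
    obtain ⟨χ, h1, h2⟩ := h
    exact ih ht.1 h1 (ih' ht.2 h2)
  | bang t => exact h.elim (fun h => M.sat_of_an hP hS h a) False.elim

/-- The closure conditions on the evidence of an agent who verifies nothing. -/
structure IsEvidence (CS : ConstSpec Agent) (i : Agent) (E : JTerm → Set (JForm Agent)) :
    Prop where
  app : ∀ s t φ χ, .imp φ χ ∈ E s → φ ∈ E t → χ ∈ E (.app s t)
  left : ∀ s t, E s ⊆ E (.sum s t)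
  right : ∀ s t, E t ⊆ E (.sum s t)
  an : ∀ t φ, AN CS t i φ → φ ∈ E t

/-- A model with one state, in which only agents 3 and 4 have successors, and in which only
agent 1 may lack evidence. -/
def pointModel (P : Set PScheme) (E : JTerm → Set (JForm Agent))
    (hE : IsEvidence CS .one E) (V : PVar → Prop) : FModel (JH P) CS Unit where
  R i _ _ := i = .three ∨ i = .four
  E i t φ := {_a | i = .one → φ ∈ E t}
  V p := {_a | V p}
  application i s t φ χ := fun _ h hi => hE.app s t φ χ (h.1 hi) (h.2 hi)
  sum i s t φ := fun _ h hi => h.elim (fun h => hE.left s t (h hi)) (fun h => hE.right s t (h hi))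
  an t i φ h := Set.eq_univ_of_forall fun _ hi => hE.an t φ (hi ▸ h)
  verification i j h t φ := by
    rintro _ - rfl
    rcases h with ⟨h, -⟩ | ⟨h, -⟩ | ⟨h, -⟩ <;> cases h
  conversion i j h t φ := by
    rintro _ - rfl
    cases h.1
  distribution i j _ t φ _ _ _ h := h
  reflexive i h := by cases i <;> cases h
  serial i h _ := by
    cases i
    · cases h
    · cases h
    · exact ⟨(), .inl rfl⟩
    · exact ⟨(), .inr rfl⟩
  ver_trans i j _ _ _ _ _ h := h
  sub_le i j h _ _ _ := .inr h.2

theorem sat_pointModel_box_one {P : Set PScheme} {E : JTerm → Set (JForm Agent)}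
    {hE : IsEvidence CS .one E} {V : PVar → Prop} {t : JTerm} {φ : JForm Agent} :
    (pointModel P E hE V).Sat (.box t .one φ) () ↔ φ ∈ E t :=
  ⟨fun h => h.1 rfl, fun h => ⟨fun _ => h, fun _ hb => by rcases hb with hb | hb <;> cases hb⟩⟩

end Evidence

/-! ### Worlds and judges -/

section Worlds

variable {P : Set PScheme} {CS : ConstSpec Agent} {m : ℕ} {ar : Fin m → ℕ} {k k' : ℕ}
  {I : (r : Fin m) → (Fin (ar r) → Bool) → Bool}

/-- The propositional variables in the world of the assignment `v`, the tuple `σ` and the argument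
places `j`: `ok_l` says that entry `l` of the tuple is the value of the variable `z_{j l}`. -/
def worldVal (I : (r : Fin m) → (Fin (ar r) → Bool) → Bool) (v σ : ℕ → Bool) (j : ℕ → ℕ) :
    PVar → Prop
  | .active => False
  | .p l => σ l = true
  | .ok l => v (j l) = σ l
  | .z i b => v i = b
  | .rel r b => ∃ h : r < m, I ⟨r, h⟩ (fun l => σ l) = b
  | .sub _ _ => False

/-- The world of `v`, `σ` and `j`; it interprets the formulas that agent 1 justifies. -/
def world (P : Set PScheme) (CS : ConstSpec Agent)
    (I : (r : Fin m) → (Fin (ar r) → Bool) → Bool) (v σ : ℕ → Bool) (j : ℕ → ℕ) :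
    FModel (JH P) CS Unit :=
  pointModel P (fun _ => Set.univ)
    ⟨fun _ _ _ _ _ _ => trivial, fun _ _ _ _ => trivial, fun _ _ _ _ => trivial,
      fun _ _ _ => trivial⟩ (worldVal I v σ j)

theorem sat_world_lit {v σ : ℕ → Bool} {j : ℕ → ℕ} {l : ℕ} {b : Bool} :
    (world P CS I v σ j).Sat (lit l b) () ↔ σ l = b := by
  cases b
  · exact (Bool.not_eq_true _).to_iff
  · exact Iff.rfl

/-- The number of occurrences of the variables `rel_r`, where an occurrence of a variable
`match(z, p_l)` that does not fit the argument places `j` counts twice. -/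
def weight (j : ℕ → ℕ) : JTerm → ℕ
  | .const _ => 0
  | .var (.rel _) => 1
  | .var (.mat z l) => if z = j l then 0 else 2
  | .var _ => 0
  | .sum s t => weight j s + weight j t
  | .app s t => weight j s + weight j t
  | .bang t => weight j t

theorem JTerm.VarFree.weight_eq_zero {t : JTerm} (h : t.VarFree) (j : ℕ → ℕ) : weight j t = 0 := by
  induction t with
  | const c => rfl
  | var x => exact h.elim
  | sum s t ih ih' => simp [weight, ih h.1, ih' h.2]
  | app s t ih ih' => simp [weight, ih h.1, ih' h.2]
  | bang t ih => exact ih h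

/-- The evidence of agent 1 in the eyes of a judge who knows the assignment `v`. A formula with a
justification that fits the argument places `j` and collects no tuple has to hold for all tuples;
with a justification that collects one tuple it has to hold for some tuple. No condition is put on
justifications that could mix several tuples. -/
def judgeEvidence (P : Set PScheme) (CS : ConstSpec Agent)
    (I : (r : Fin m) → (Fin (ar r) → Bool) → Bool) (v : ℕ → Bool) (t : JTerm) :
    Set (JForm Agent) :=
  {φ | ∀ j, (weight j t = 0 → ∀ σ, (world P CS I v σ j).Sat φ ()) ∧
    (weight j t = 1 → ∃ σ, (world P CS I v σ j).Sat φ ())}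

theorem mem_judgeEvidence_of_forall {v : ℕ → Bool} {t : JTerm} {φ : JForm Agent}
    (h : ∀ j, weight j t ≤ 1 → ∀ σ, (world P CS I v σ j).Sat φ ()) :
    φ ∈ judgeEvidence P CS I v t :=
  fun j => ⟨fun hj => h j (by omega), fun hj => ⟨fun _ => true, h j (by omega) _⟩⟩

theorem isEvidence_judgeEvidence (hP : ∀ σ ∈ P, σ.Tautology) (hS : (JH P).Schematic CS)
    (v : ℕ → Bool) : IsEvidence CS .one (judgeEvidence P CS I v) where
  app s t φ χ hs ht j := by
    simp only [weight]
    refine ⟨fun h σ => (hs j).1 (by omega) σ ((ht j).1 (by omega) σ), fun h => ?_⟩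
    rcases Nat.eq_zero_or_pos (weight j s) with h0 | h0
    · obtain ⟨σ, hσ⟩ := (ht j).2 (by omega)
      exact ⟨σ, (hs j).1 h0 σ hσ⟩
    · obtain ⟨σ, hσ⟩ := (hs j).2 (by omega)
      exact ⟨σ, hσ ((ht j).1 (by omega) σ)⟩
  left s t φ h j := by
    simp only [weight]
    refine ⟨fun h' => (h j).1 (by omega), fun h' => ?_⟩
    rcases Nat.eq_zero_or_pos (weight j s) with h0 | h0
    · exact ⟨fun _ => true, (h j).1 h0 _⟩
    · exact (h j).2 (by omega)
  right s t φ h j := by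
    simp only [weight]
    refine ⟨fun h' => (h j).1 (by omega), fun h' => ?_⟩
    rcases Nat.eq_zero_or_pos (weight j t) with h0 | h0
    · exact ⟨fun _ => true, (h j).1 h0 _⟩
    · exact (h j).2 (by omega)
  an t φ h := mem_judgeEvidence_of_forall fun _ _ _ => FModel.sat_of_an hP hS _ h _

/-- The judge of the assignment `v` interprets the formulas that agent 2 justifies; `[ψ_a]^△` means
that `△` is the truth value of `ψ_a` under `v`. -/
def judge (hP : ∀ σ ∈ P, σ.Tautology) (hS : (JH P).Schematic CS)
    (I : (r : Fin m) → (Fin (ar r) → Bool) → Bool) (Ψ : List (Matr m ar k k')) (v : ℕ → Bool) :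
    FModel (JH P) CS Unit :=
  pointModel P (judgeEvidence P CS I v) (isEvidence_judgeEvidence hP hS v) fun
    | .sub a b => ∃ γ, Ψ[a]? = some γ ∧ γ.eval I v = b
    | _ => False

theorem sat_judge_subVar {hP : ∀ σ ∈ P, σ.Tautology} {hS : (JH P).Schematic CS}
    {Ψ : List (Matr m ar k k')} {v : ℕ → Bool} {γ : Matr m ar k k'} (hγ : γ ∈ Ψ) {b : Bool} :
    (judge hP hS I Ψ v).Sat (subVar Ψ γ b) () ↔ γ.eval I v = b := by
  have h : Ψ[Ψ.idxOf γ]? = some γ := by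
    rw [List.getElem?_eq_getElem (List.idxOf_lt_length_of_mem hγ), List.getElem_idxOf]
  change (∃ δ, Ψ[Ψ.idxOf γ]? = some δ ∧ δ.eval I v = b) ↔ _
  rw [h]
  simp

end Worlds

/-! ### Variables in the terms of the reduction -/

section TermVariables

variable {P : Set PScheme} {CS : ConstSpec Agent} {B : BasicTerms} {m : ℕ} {ar : Fin m → ℕ}
  {k k' : ℕ}

theorem BasicTerms.Suitable.varFree_proj (hB : B.Suitable (JH P) CS) (r x : ℕ) :
    (B.proj r x).VarFree := by
  have h := hB.varFree
  simp only [List.mem_cons, List.not_mem_nil, or_false, forall_eq_or_imp, forall_eq] at h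
  induction r with
  | zero => exact h.2.2.2.2.2.1
  | succ r ih =>
    rw [BasicTerms.proj]
    split_ifs
    · exact h.2.2.2.2.2.1
    · exact h.2.2.2.2.1
    · exact ⟨⟨h.2.2.2.2.2.2.1, h.2.2.2.1⟩, ih⟩

theorem BasicTerms.Suitable.varFree_replace (hB : B.Suitable (JH P) CS) (r x : ℕ) :
    (B.replace r x).VarFree := by
  have h := hB.varFree
  simp only [List.mem_cons, List.not_mem_nil, or_false, forall_eq_or_imp, forall_eq] at h
  induction r with
  | zero => exact h.2.2.2.2.2.1
  | succ r ih =>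
    rw [BasicTerms.replace]
    split_ifs
    · exact h.2.2.2.2.2.1
    · exact h.2.2.2.2.2.2.2.2.2.1
    · exact ⟨⟨h.2.2.2.2.2.2.1, ih⟩, h.2.2.2.2.2.2.2.2.1⟩

theorem allVars_appendAll {p : JVar → Prop} (hB : B.append.VarFree) (l : List JTerm)
    (h : ∀ t ∈ l, t.AllVars p) : (B.appendAll l).AllVars p := by
  induction l using List.reverseRecOn with
  | nil => trivial
  | append_singleton l t ih =>
    rcases eq_or_ne l [] with rfl | hl
    · exact h t (by simp)
    · rw [BasicTerms.appendAll, chainTerm_concat _ hl]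
      exact ⟨⟨hB.allVars p, ih fun s hs => h s (by simp [hs])⟩, h t (by simp)⟩

theorem weight_appendAll (j : ℕ → ℕ) (hB : B.append.VarFree) (l : List JTerm) :
    weight j (B.appendAll l) = (l.map (weight j)).sum := by
  induction l using List.reverseRecOn with
  | nil => rfl
  | append_singleton l t ih =>
    rcases eq_or_ne l [] with rfl | hl
    · simp [BasicTerms.appendAll, chainTerm]
    · rw [BasicTerms.appendAll, chainTerm_concat _ hl]
      rw [BasicTerms.appendAll] at ih
      simp only [weight, ih, hB.weight_eq_zero j]
      simp

theorem weight_gather (j : ℕ → ℕ) (hB : B.append.VarFree) (r : Fin m) :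
    weight j (gather B ar r) = 1 := by
  rw [gather, weight_appendAll j hB]
  simp [weight, Function.comp_def]

theorem weight_allValues (j : ℕ → ℕ) (hB : B.append.VarFree) (ρ₀ : ℕ) :
    weight j (allValues B ρ₀) = 0 := by
  rw [allValues, weight_appendAll j hB]
  simp [weight, Function.comp_def]

theorem weight_matchStep (hB : B.Suitable (JH P) CS) (j : ℕ → ℕ) (A : Atom m ar k k')
    (b : Fin (ar A.r)) :
    weight j (matchStep B A b) = if (A.args b : ℕ) = j b then 0 else 2 := by
  have h := hB.varFree B.tran (by simp)
  simp only [matchStep, weight, h.weight_eq_zero, (hB.varFree_proj _ _).weight_eq_zero,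
    (hB.varFree_replace _ _).weight_eq_zero, zero_add, add_zero]

theorem weight_matchTerm (hB : B.Suitable (JH P) CS) (j : ℕ → ℕ) (A : Atom m ar k k')
    (hj : ∀ b : Fin (ar A.r), (A.args b : ℕ) = j b) : weight j (matchTerm B A) = 1 := by
  refine List.foldl_finRange_induction _ (fun _ t => weight j t = 1) _ ?_ ?_
  · simp [weight, weight_gather j (hB.varFree B.append (by simp)),
      (hB.varFree B.addhyp (by simp)).weight_eq_zero]
  · intro b t ht
    simp [weight, ht, weight_matchStep hB, hj b,
      (hB.varFree B.mphypoth (by simp)).weight_eq_zero]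

end TermVariables

/-! ### The model of a two-element structure -/

section Countermodel

variable {P : Set PScheme} {CS : ConstSpec Agent} {B : BasicTerms} {m : ℕ} {ar : Fin m → ℕ}
  {k k' : ℕ} {I : (r : Fin m) → (Fin (ar r) → Bool) → Bool} {x : ℕ → Bool}
  {Ψ : List (Matr m ar k k')}

open JForm

/-- The basic evidence of agent 1 at a state; the state `σ + 1` represents the tuple of the binary
digits of `σ`. -/
def basicOne (P : Set PScheme) (CS : ConstSpec Agent)
    (I : (r : Fin m) → (Fin (ar r) → Bool) → Bool) (x : ℕ → Bool) (k n s : ℕ) :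
    JVar → Set (JForm Agent)
  | .bit _ => {φ | ∃ σ < 2 ^ n, s = σ + 1 ∧ ∀ v j, (world P CS I v σ.testBit j).Sat φ ()}
  | .rel _ => {φ | ∃ σ < 2 ^ n, s = σ + 1 ∧ ∀ v j, (world P CS I v σ.testBit j).Sat φ ()}
  | .value z => {φ | ∃ b, (z < k → b = x z) ∧ φ = var (.z z b)}
  | .mat z l => {φ | ∀ v σ j, z = j l → (world P CS I v σ j).Sat φ ()}
  | _ => ∅

/-- The evidence of agent 1 at a state. -/
def evidenceOne (P : Set PScheme) (CS : ConstSpec Agent)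
    (I : (r : Fin m) → (Fin (ar r) → Bool) → Bool) (x : ℕ → Bool) (k n s : ℕ) :
    JTerm → Set (JForm Agent) :=
  evidence CS .one (basicOne P CS I x k n s) fun _ => ∅

/-- The evidence of agent 2, which is the same at all states: variables justify what all judges of
an admissible assignment accept, and the evidence of agent 1 at any state is verified. -/
def evidenceTwo (hP : ∀ σ ∈ P, σ.Tautology) (hS : (JH P).Schematic CS)
    (I : (r : Fin m) → (Fin (ar r) → Bool) → Bool) (x : ℕ → Bool) (k n : ℕ)
    (Ψ : List (Matr m ar k k')) : JTerm → Set (JForm Agent) :=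
  evidence CS .two
    (fun _ => {φ | ∀ v : ℕ → Bool, (∀ i < k, v i = x i) → (judge hP hS I Ψ v).Sat φ ()})
    fun t => {φ | ∃ s, ∃ χ ∈ evidenceOne P CS I x k n s t, φ = box t .one χ}

/-- All admissible judges accept all formulas that the term justifies for agent 2. -/
def AllAccept (hP : ∀ σ ∈ P, σ.Tautology) (hS : (JH P).Schematic CS)
    (I : (r : Fin m) → (Fin (ar r) → Bool) → Bool) (x : ℕ → Bool) (k n : ℕ)
    (Ψ : List (Matr m ar k k')) (t : JTerm) : Prop :=
  ∀ φ ∈ evidenceTwo hP hS I x k n Ψ t, ∀ v : ℕ → Bool, (∀ i < k, v i = x i) →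
    (judge hP hS I Ψ v).Sat φ ()

/-- Each formula that the term justifies for agent 2 is accepted by some admissible judge. -/
def SomeAccept (hP : ∀ σ ∈ P, σ.Tautology) (hS : (JH P).Schematic CS)
    (I : (r : Fin m) → (Fin (ar r) → Bool) → Bool) (x : ℕ → Bool) (k n : ℕ)
    (Ψ : List (Matr m ar k k')) (t : JTerm) : Prop :=
  ∀ φ ∈ evidenceTwo hP hS I x k n Ψ t, ∃ v : ℕ → Bool, (∀ i < k, v i = x i) ∧
    (judge hP hS I Ψ v).Sat φ ()

variable {hP : ∀ σ ∈ P, σ.Tautology} {hS : (JH P).Schematic CS} {n : ℕ}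

theorem AllAccept.app {s t : JTerm} (hs : AllAccept hP hS I x k n Ψ s)
    (ht : AllAccept hP hS I x k n Ψ t) : AllAccept hP hS I x k n Ψ (.app s t) := by
  rintro χ ⟨φ, h1, h2⟩ v hv
  exact hs _ h1 v hv (ht _ h2 v hv)

theorem AllAccept.app_someAccept {s t : JTerm} (hs : AllAccept hP hS I x k n Ψ s)
    (ht : SomeAccept hP hS I x k n Ψ t) : SomeAccept hP hS I x k n Ψ (.app s t) := by
  rintro χ ⟨φ, h1, h2⟩
  obtain ⟨v, hv, h⟩ := ht _ h2
  exact ⟨v, hv, hs _ h1 v hv h⟩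

theorem allAccept_var (y : JVar) : AllAccept hP hS I x k n Ψ (.var y) := fun _ h => h

theorem allAccept_const (c : ℕ) : AllAccept hP hS I x k n Ψ (.const c) :=
  fun _ h v _ => (judge hP hS I Ψ v).sat_of_isAxiom hP (hS.isAxiom h) ()

theorem allAccept_bang {t : JTerm} (h : ∀ s, ∀ φ ∈ evidenceOne P CS I x k n s t,
    ∀ v, φ ∈ judgeEvidence P CS I v t) : AllAccept hP hS I x k n Ψ (.bang t) := by
  rintro φ (hφ | ⟨s, χ, hχ, rfl⟩) v -
  · exact (judge hP hS I Ψ v).sat_of_an hP hS hφ ()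
  · exact sat_pointModel_box_one.2 (h s χ hχ v)

/-- If the basic evidence of all variables in a term holds in all worlds whose argument places fit
the term, then a judge credits agent 1 with all evidence that the term provides. -/
theorem mem_judgeEvidence_of_allVars (hP : ∀ σ ∈ P, σ.Tautology) (hS : (JH P).Schematic CS)
    {s : ℕ} {t : JTerm} {v : ℕ → Bool}
    (ht : ∀ j, weight j t ≤ 1 → ∀ σ, t.AllVars fun y =>
      ∀ φ ∈ basicOne P CS I x k n s y, (world P CS I v σ j).Sat φ ()) :
    ∀ φ ∈ evidenceOne P CS I x k n s t, φ ∈ judgeEvidence P CS I v t :=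
  fun _ hφ => mem_judgeEvidence_of_forall fun j hj σ =>
    FModel.sat_of_mem_evidence hP hS _ _ (ht j hj σ) hφ

theorem allAccept_of_varFree {t : JTerm} (ht : t.VarFree) : AllAccept hP hS I x k n Ψ t := by
  induction t with
  | const c => exact allAccept_const c
  | var y => exact ht.elim
  | sum s t ih ih' =>
    rintro φ (h | h)
    · exact ih ht.1 φ h
    · exact ih' ht.2 φ h
  | app s t ih ih' => exact (ih ht.1).app (ih' ht.2)
  | bang t _ =>
    exact allAccept_bang fun s φ hφ v =>
      mem_judgeEvidence_of_allVars (t := t) hP hS (fun _ _ _ => JTerm.VarFree.allVars ht _) φ hφ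

theorem allAccept_bang_of_varFree {t : JTerm} (ht : t.VarFree) :
    AllAccept hP hS I x k n Ψ (.bang t) :=
  allAccept_of_varFree (t := .bang t) ht

/-- The tuple collected by `gather` is that of a single state. -/
theorem allAccept_bang_gather (hB : B.Suitable (JH P) CS) (r : Fin m) :
    AllAccept hP hS I x k n Ψ (.bang (gather B ar r)) := by
  have happ := hB.varFree B.append (by simp)
  refine allAccept_bang fun s φ hφ v j => ⟨fun h => ?_, fun _ => ⟨(s - 1).testBit, ?_⟩⟩
  · rw [weight_gather j happ] at h
    cases h
  · refine FModel.sat_of_mem_evidence hP hS _ _ (allVars_appendAll happ _ fun t ht => ?_) hφ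
    simp only [List.mem_append, List.mem_map, List.mem_range, List.mem_singleton] at ht
    rcases ht with ⟨b, -, rfl⟩ | rfl
    · rintro φ ⟨σ, -, rfl, h⟩
      exact h v j
    · rintro φ ⟨σ, -, rfl, h⟩
      exact h v j

theorem allAccept_bang_matchStep (hB : B.Suitable (JH P) CS) (A : Atom m ar k k')
    (b : Fin (ar A.r)) : AllAccept hP hS I x k n Ψ (.bang (matchStep B A b)) := by
  have htran := hB.varFree B.tran (by simp)
  refine allAccept_bang fun s φ hφ v => mem_judgeEvidence_of_allVars hP hS (fun j hj σ => ?_) φ hφ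
  rw [weight_matchStep hB] at hj
  have hfit : (A.args b : ℕ) = j b := by
    by_contra h
    rw [if_neg h] at hj
    omega
  exact ⟨⟨htran.allVars _, ⟨htran.allVars _, (hB.varFree_proj _ _).allVars _⟩,
    fun φ hφ => hφ v σ j hfit⟩, (hB.varFree_replace _ _).allVars _⟩

theorem allAccept_matchBang (hB : B.Suitable (JH P) CS) (A : Atom m ar k k') :
    AllAccept hP hS I x k n Ψ (matchBang B A) := by
  refine List.foldl_finRange_induction _ (fun _ t => AllAccept hP hS I x k n Ψ t) _ ?_ ?_
  · exact ((allAccept_const _).app (allAccept_bang_of_varFree (hB.varFree _ (by simp)))).app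
      (allAccept_bang_gather hB _)
  · intro b t ht
    exact ((allAccept_const _).app (((allAccept_const _).app
      (allAccept_bang_of_varFree (hB.varFree _ (by simp)))).app ht)).app
      (allAccept_bang_matchStep hB A b)

theorem allAccept_gathrel (hB : B.Suitable (JH P) CS) :
    AllAccept hP hS I x k n Ψ (gathrel B Ψ) := by
  rw [gathrel]
  generalize atomsOf Ψ = l
  induction l using List.reverseRecOn with
  | nil => exact allAccept_const _
  | append_singleton l A ih =>
    have hA := (allAccept_const (hP := hP) (hS := hS) (I := I) (x := x) (k := k) (n := n) (Ψ := Ψ)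
      B.cApp).app (allAccept_matchBang hB A)
    rcases eq_or_ne l [] with rfl | hl
    · exact hA
    · rw [List.map_append, List.map_singleton, chainTerm_concat _ (by simpa using hl)]
      exact ((allAccept_of_varFree (hB.varFree _ (by simp))).app ih).app hA

/-- A justification by the collection of the values selects one value for each variable, because
every variable `value_z` occurs once. -/
theorem exists_assignment_of_mem_allValues (hP : ∀ σ ∈ P, σ.Tautology)
    (hS : (JH P).Schematic CS) (hB : B.Suitable (JH P) CS) {s r : ℕ} {φ : JForm Agent}
    (hφ : φ ∈ evidenceOne P CS I x k n s (allValues B (r + 1))) :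
    ∃ u : ℕ → Bool, (∀ i < k, u i = x i) ∧ ∀ v : ℕ → Bool, (∀ i ≤ r, v i = u i) →
      ∀ σ j, (world P CS I v σ j).Sat φ () := by
  induction r generalizing φ with
  | zero =>
    obtain ⟨b, hb, rfl⟩ := hφ
    refine ⟨fun i => if i = 0 then b else x i, fun i hi => ?_, fun v hv σ j => ?_⟩
    · dsimp only
      split_ifs with h
      · subst h
        exact hb hi
      · rfl
    · exact hv 0 le_rfl
  | succ r ih =>
    rw [allValues, BasicTerms.appendAll, List.range_succ, List.map_append, List.map_singleton,
      chainTerm_concat _ (by simp)] at hφ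
    obtain ⟨φ₂, ⟨φ₁, h0, h1⟩, b, hb, rfl⟩ := hφ
    obtain ⟨u, hu, hu'⟩ := ih h1
    refine ⟨Function.update u (r + 1) b, fun i hi => ?_, fun v hv σ j => ?_⟩
    · rcases eq_or_ne i (r + 1) with rfl | h
      · rw [Function.update_self]
        exact hb hi
      · rw [Function.update_of_ne h]
        exact hu i hi
    · refine FModel.sat_of_mem_evidence hP hS (world P CS I v σ j) ()
        ((hB.varFree B.append (by simp)).allVars _) h0 (hu' v (fun i hi => ?_) σ j) ?_
      · rw [hv i (by omega), Function.update_of_ne (by omega)]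
      · have := hv (r + 1) le_rfl
        rwa [Function.update_self] at this

theorem someAccept_bang_allValues (hB : B.Suitable (JH P) CS) {r : ℕ} (hr : 0 < r) :
    SomeAccept hP hS I x k n Ψ (.bang (allValues B r)) := by
  rintro φ (hφ | ⟨s, χ, hχ, rfl⟩)
  · exact ⟨x, fun _ _ => rfl, (judge hP hS I Ψ x).sat_of_an hP hS hφ ()⟩
  · obtain ⟨r, rfl⟩ : ∃ r', r = r' + 1 := ⟨r - 1, by omega⟩
    obtain ⟨u, hu, h⟩ := exists_assignment_of_mem_allValues hP hS hB hχ
    exact ⟨u, hu, sat_pointModel_box_one.2 (mem_judgeEvidence_of_forall fun j _ σ =>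
      h u (fun _ _ => rfl) σ j)⟩

theorem someAccept_tTerm (hB : B.Suitable (JH P) CS) (hk : 0 < k + k') (c : ℕ) :
    SomeAccept hP hS I x k n Ψ (tTerm B Ψ c) := by
  have hfree : ∀ {t : JTerm}, t.VarFree → AllAccept hP hS I x k n Ψ t := allAccept_of_varFree
  have hproj := fun r y => hfree (hB.varFree_proj r y)
  have htran := hfree (hB.varFree B.tran (by simp))
  have hhyp := hfree (hB.varFree B.hypappend (by simp))
  have hconc := hfree (hB.varFree B.appendconc (by simp))
  induction c with
  | zero => exact (allAccept_gathrel hB).app_someAccept (someAccept_bang_allValues hB hk)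
  | succ c ih =>
    have hbin : ∀ γ δ : Matr m ar k k', SomeAccept hP hS I x k n Ψ
        (B.hypappend ⬝ₜ (B.tran ⬝ₜ (B.appendconc ⬝ₜ B.proj c (Ψ.idxOf γ) ⬝ₜ B.proj c (Ψ.idxOf δ))
          ⬝ₜ .var (.truth c)) ⬝ₜ tTerm B Ψ c) := fun γ δ =>
      (hhyp.app ((htran.app ((hconc.app (hproj _ _)).app (hproj _ _))).app
        (allAccept_var _))).app_someAccept ih
    rw [tTerm]
    split
    · exact ih
    · exact ((hfree (hB.varFree_replace _ _)).app (allAccept_var _)).app_someAccept ih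
    · exact (hhyp.app ((htran.app (hproj _ _)).app (allAccept_var _))).app_someAccept ih
    · exact hbin _ _
    · exact hbin _ _
    · exact hbin _ _

/-- The formulas `Eval` are accepted by all judges. For an atom, a justification by `match` of a
value of the relation symbol fits the arguments of the atom, so that it stems from the tuple of
their values. -/
theorem judge_accepts_eval (hB : B.Suitable (JH P) CS) {χ γ : Matr m ar k k'}
    (hΨ : IsOrdering χ Ψ) (hγ : γ ∈ Ψ) (M : FModel (JH P) CS ℕ) (s : ℕ)
    (hM : ∀ c φ, (∀ v, (judge hP hS I Ψ v).Sat φ ()) → M.Sat (box (.var (.truth c)) .two φ) s) :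
    M.Sat (evalForm B Ψ γ) s := by
  have hbin : ∀ δ ε : Matr m ar k k', δ ∈ Ψ → ε ∈ Ψ → ∀ f : Bool → Bool → Bool,
      (∀ v, γ.eval I v = f (δ.eval I v) (ε.eval I v)) → M.Sat (evalBin Ψ γ δ ε f) s := by
    intro δ ε hδ hε f hf
    rw [evalBin, M.sat_conj]
    intro θ hθ
    obtain ⟨b, -, rfl⟩ := List.mem_map.1 hθ
    refine hM _ _ fun v h => ?_
    rw [sat_judge_subVar hγ, hf, (sat_judge_subVar hδ).1 h.1, (sat_judge_subVar hε).1 h.2]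
  cases γ with
  | atom A =>
    rw [evalForm, M.sat_conj]
    intro θ hθ
    obtain ⟨b, -, rfl⟩ := List.mem_map.1 hθ
    refine hM _ _ fun v h => (sat_judge_subVar hγ).2 ?_
    obtain ⟨j, hj⟩ : ∃ j : ℕ → ℕ, ∀ c : Fin (ar A.r), (A.args c : ℕ) = j c :=
      ⟨fun l => if h : l < ar A.r then A.args ⟨l, h⟩ else 0, fun c => by simp⟩
    obtain ⟨σ, hσ⟩ := (sat_pointModel_box_one.1 h j).2 (by
      simp [weight, weight_matchTerm hB j A hj,
        weight_allValues j (hB.varFree B.append (by simp))])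
    rw [FModel.sat_conj] at hσ
    obtain ⟨_, hI⟩ := hσ (var (.rel A.r b)) (by simp)
    rw [← hI]
    refine congrArg (I A.r) (funext fun c => ?_)
    rw [hj c]
    exact hσ (var (.ok c)) (by simp)
  | neg γ =>
    rw [evalForm, M.sat_conj]
    intro θ hθ
    obtain ⟨b, -, rfl⟩ := List.mem_map.1 hθ
    refine hM _ _ fun v h => (sat_judge_subVar hγ).2 ?_
    rw [Matr.eval, (sat_judge_subVar (hΨ.mem hγ (by simp [Matr.subs, Matr.mem_subs_self]))).1 h]
  | or γ δ =>
    exact hbin γ δ (hΨ.mem hγ (by simp [Matr.subs, Matr.mem_subs_self]))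
      (hΨ.mem hγ (by simp [Matr.subs, Matr.mem_subs_self])) _ fun v => rfl
  | and γ δ =>
    exact hbin γ δ (hΨ.mem hγ (by simp [Matr.subs, Matr.mem_subs_self]))
      (hΨ.mem hγ (by simp [Matr.subs, Matr.mem_subs_self])) _ fun v => rfl
  | imp γ δ =>
    exact hbin γ δ (hΨ.mem hγ (by simp [Matr.subs, Matr.mem_subs_self]))
      (hΨ.mem hγ (by simp [Matr.subs, Matr.mem_subs_self])) (fun b c => !b || c) fun v => rfl

/-- The model: state `0` is the initial one, the state `σ + 1` with `σ < 2 ^ n` represents the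
tuple of the binary digits of `σ`, and the states beyond `2 ^ n` are not active. -/
def chainModel (hP : ∀ σ ∈ P, σ.Tautology) (hS : (JH P).Schematic CS)
    (I : (r : Fin m) → (Fin (ar r) → Bool) → Bool) (x : ℕ → Bool) (n : ℕ)
    (Ψ : List (Matr m ar k k')) : FModel (JH P) CS ℕ where
  R
    | .one, _, _ => False
    | .two, _, _ => False
    | .three, s, t => t = s + 1
    | .four, s, t => s < t
  E
    | .one, t, φ => {s | φ ∈ evidenceOne P CS I x k n s t}
    | .two, t, φ => {_s | φ ∈ evidenceTwo hP hS I x k n Ψ t}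
    | .three, _, _ => Set.univ
    | .four, _, _ => Set.univ
  V p := {s | p = .active ∧ 1 ≤ s ∧ s ≤ 2 ^ n}
  application i s t φ χ := by
    cases i
    · exact fun a h => ⟨φ, h.1, h.2⟩
    · exact fun a h => ⟨φ, h.1, h.2⟩
    · exact fun a _ => trivial
    · exact fun a _ => trivial
  sum i s t φ := by
    cases i
    · exact fun a h => h
    · exact fun a h => h
    · exact fun a _ => trivial
    · exact fun a _ => trivial
  an t i φ h := by
    refine Set.eq_univ_of_forall fun a => ?_
    cases i
    · exact AN.mem_evidence h
    · exact AN.mem_evidence h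
    · trivial
    · trivial
  verification i j h t φ := by
    rcases h with ⟨rfl, rfl⟩ | ⟨rfl, rfl⟩ | ⟨rfl, rfl⟩
    · exact fun a h => .inr ⟨a, φ, h, rfl⟩
    · exact fun a _ => trivial
    · exact fun a _ => trivial
  conversion i j h t φ := by
    rcases h with ⟨rfl, rfl⟩
    exact fun a _ => trivial
  distribution i j h t φ a b hab ha := by
    rcases h with ⟨rfl, rfl⟩ | ⟨rfl, rfl⟩ | ⟨rfl, rfl⟩
    · exact hab.elim
    · exact ha
    · trivial
  reflexive i h := by cases i <;> cases h
  serial i h a := by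
    cases i
    · cases h
    · cases h
    · exact ⟨a + 1, rfl⟩
    · exact ⟨a + 1, Nat.lt_succ_self a⟩
  ver_trans i j h a b c hab hbc := by
    rcases h with ⟨rfl, rfl⟩ | ⟨rfl, rfl⟩ | ⟨rfl, rfl⟩
    · exact hbc
    · exact hbc
    · exact lt_trans hab hbc
  sub_le i j h a b hab := by
    rcases h with ⟨rfl, rfl⟩
    have hab : b = a + 1 := hab
    exact hab ▸ Nat.lt_succ_self a

theorem sat_chainModel_box_one {s : ℕ} {t : JTerm} {φ : JForm Agent} :
    (chainModel hP hS I x n Ψ).Sat (box t .one φ) s ↔ φ ∈ evidenceOne P CS I x k n s t :=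
  ⟨fun h => h.1, fun h => ⟨h, fun _ hb => hb.elim⟩⟩

theorem sat_chainModel_box_two {s : ℕ} {t : JTerm} {φ : JForm Agent} :
    (chainModel hP hS I x n Ψ).Sat (box t .two φ) s ↔ φ ∈ evidenceTwo hP hS I x k n Ψ t :=
  ⟨fun h => h.1, fun h => ⟨h, fun _ hb => hb.elim⟩⟩

theorem sat_chainModel_rho_three {s : ℕ} {φ : JForm Agent} :
    (chainModel hP hS I x n Ψ).Sat (rhoBox .three φ) s ↔
      (chainModel hP hS I x n Ψ).Sat φ (s + 1) :=
  ⟨fun h => h.2 _ rfl, fun h => ⟨trivial, fun _ hb => hb ▸ h⟩⟩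

theorem sat_chainModel_rho_four {s : ℕ} {φ : JForm Agent} :
    (chainModel hP hS I x n Ψ).Sat (rhoBox .four φ) s ↔
      ∀ t, s < t → (chainModel hP hS I x n Ψ).Sat φ t :=
  ⟨fun h => h.2, fun h => ⟨trivial, h⟩⟩

theorem sat_chainModel_act {s : ℕ} :
    (chainModel hP hS I x n Ψ).Sat act s ↔ 1 ≤ s ∧ s ≤ 2 ^ n :=
  ⟨fun h => h.2, fun h => ⟨rfl, h⟩⟩

theorem sat_chainModel_bitBox {σ b : ℕ} (hσ : σ < 2 ^ n) {e : Bool} :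
    (chainModel hP hS I x n Ψ).Sat (bitBox b e) (σ + 1) ↔ σ.testBit b = e := by
  rw [bitBox, sat_chainModel_box_one]
  constructor
  · rintro ⟨τ, -, h, h'⟩
    obtain rfl : σ = τ := by omega
    exact sat_world_lit.1 (h' (fun _ => true) fun _ => 0)
  · exact fun h => ⟨σ, hσ, rfl, fun v j => sat_world_lit.2 h⟩

theorem sat_chainModel_someZeroBelow {σ a : ℕ} (hσ : σ < 2 ^ n) :
    (chainModel hP hS I x n Ψ).Sat (someZeroBelow a) (σ + 1) ↔ ∃ b < a, σ.testBit b = false := by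
  rw [someZeroBelow, FModel.sat_disj]
  simp only [List.mem_map, List.mem_range]
  constructor
  · rintro ⟨_, ⟨b, hb, rfl⟩, h⟩
    exact ⟨b, hb, (sat_chainModel_bitBox hσ).1 h⟩
  · rintro ⟨b, hb, h⟩
    exact ⟨_, ⟨b, hb, rfl⟩, (sat_chainModel_bitBox hσ).2 h⟩

/-- A formula about the active states has to be checked at the states `σ + 1` with `σ < 2 ^ n`. -/
theorem sat_chainModel_of_active {χ θ : JForm Agent} {s : ℕ}
    (hact : (chainModel hP hS I x n Ψ).Sat χ s → (chainModel hP hS I x n Ψ).Sat act s)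
    (h : ∀ σ < 2 ^ n, s = σ + 1 → (chainModel hP hS I x n Ψ).Sat χ (σ + 1) →
      (chainModel hP hS I x n Ψ).Sat θ (σ + 1)) :
    (chainModel hP hS I x n Ψ).Sat (imp χ θ) s := by
  intro hχ
  obtain ⟨h1, h2⟩ := sat_chainModel_act.1 (hact hχ)
  obtain ⟨σ, rfl⟩ : ∃ σ, s = σ + 1 := ⟨s - 1, by omega⟩
  exact h σ (by omega) rfl hχ

theorem sat_chainModel_startForm : (chainModel hP hS I x n Ψ).Sat (startForm n) 0 := by
  refine ⟨fun h => by have := sat_chainModel_act.1 h; omega, sat_chainModel_rho_three.2 ?_⟩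
  rw [FModel.sat_conj]
  intro θ hθ
  have hpos : 0 < 2 ^ n := by positivity
  rcases List.mem_cons.1 hθ with rfl | hθ
  · exact sat_chainModel_act.2 ⟨le_rfl, hpos⟩
  · obtain ⟨b, -, rfl⟩ := List.mem_map.1 hθ
    exact (sat_chainModel_bitBox hpos).2 (by simp)

theorem sat_chainModel_forwardA : (chainModel hP hS I x n Ψ).Sat (forwardA n) 0 := by
  refine sat_chainModel_rho_four.2 fun s _ => sat_chainModel_of_active (fun h => h.2) ?_
  rintro σ hσ - ⟨h, -⟩
  obtain ⟨b, hb, h⟩ := (sat_chainModel_someZeroBelow hσ).1 h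
  have := Nat.add_one_lt_two_pow_of_testBit hσ hb h
  exact sat_chainModel_rho_three.2 (sat_chainModel_act.2 (by omega))

theorem sat_chainModel_forwardB : (chainModel hP hS I x n Ψ).Sat (forwardB n) 0 := by
  refine sat_chainModel_rho_four.2 fun s _ => ?_
  rw [FModel.sat_conj]
  intro θ hθ
  obtain ⟨a, ha, rfl⟩ := List.mem_map.1 hθ
  rw [List.mem_range] at ha
  rw [conj_concat (by simp [lowBits])]
  refine sat_chainModel_of_active (fun h => h.2) ?_
  rintro σ hσ - ⟨h, -⟩
  obtain ⟨h1, h2⟩ := FModel.sat_conj_lowBits.1 h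
  have h1 : ∀ b < a, σ.testBit b = true := fun b hb => (sat_chainModel_bitBox hσ).1 (h1 b hb)
  have h2 : σ.testBit a = false := (sat_chainModel_bitBox hσ).1 h2
  have hlt := Nat.add_one_lt_two_pow_of_testBit hσ ha h2
  refine sat_chainModel_rho_three.2 (FModel.sat_conj_lowBits.2 ⟨fun b hb => ?_, ?_⟩)
  · rw [sat_chainModel_bitBox hlt, Nat.testBit_succ_eq, h1 b hb,
      decide_eq_true fun c hc => h1 c (by omega)]
    rfl
  · rw [sat_chainModel_bitBox hlt, Nat.testBit_succ_eq, h2, decide_eq_true h1]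
    rfl

/-- A bit above a zero bit is not changed by the counter; this covers `forwardC` and `forwardD`. -/
theorem sat_chainModel_forwardCD (e : Bool) :
    (chainModel hP hS I x n Ψ).Sat (rhoBox .four (conj ((List.range n).map fun a =>
      imp (conj [someZeroBelow a, bitBox a e, act]) (rhoBox .three (bitBox a e))))) 0 := by
  refine sat_chainModel_rho_four.2 fun s _ => ?_
  rw [FModel.sat_conj]
  intro θ hθ
  obtain ⟨a, ha, rfl⟩ := List.mem_map.1 hθ
  rw [List.mem_range] at ha
  refine sat_chainModel_of_active (fun h => h.2) ?_
  rintro σ hσ - ⟨⟨h1, h2⟩, -⟩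
  obtain ⟨b, hb, h1⟩ := (sat_chainModel_someZeroBelow hσ).1 h1
  have h2 := (sat_chainModel_bitBox hσ).1 h2
  have hlt := Nat.add_one_lt_two_pow_of_testBit hσ (by omega : b < n) h1
  rw [sat_chainModel_rho_three, sat_chainModel_bitBox hlt, Nat.testBit_succ_eq, h2,
    decide_eq_false (fun h => by rw [h b hb] at h1; cases h1), Bool.xor_false]

theorem sat_chainModel_endForm : (chainModel hP hS I x n Ψ).Sat (endForm n) 0 := by
  refine sat_chainModel_rho_four.2 fun s _ => sat_chainModel_of_active (fun h => ?_) ?_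
  · exact (FModel.sat_conj _ _ _).1 h _ (by simp)
  · intro σ hσ _ h
    refine sat_chainModel_rho_four.2 fun t ht hact => ?_
    rw [sat_chainModel_act] at hact
    obtain ⟨b, hb, hb'⟩ := Nat.exists_testBit_eq_false (show σ + 1 < 2 ^ n by omega)
    have := (FModel.sat_conj _ _ _).1 h (bitBox b true) (by simp; exact .inl ⟨b, hb, rfl⟩)
    rw [sat_chainModel_bitBox hσ, hb'] at this
    cases this

theorem sat_chainModel_choiceR : (chainModel hP hS I x n Ψ).Sat (choiceR m) 0 := by
  refine sat_chainModel_rho_four.2 fun s _ => sat_chainModel_of_active id ?_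
  intro σ hσ _ _
  rw [FModel.sat_conj]
  intro θ hθ
  obtain ⟨r, hr, rfl⟩ := List.mem_map.1 hθ
  rw [List.mem_range] at hr
  have : (chainModel hP hS I x n Ψ).Sat (relBox r (I ⟨r, hr⟩ fun l => σ.testBit l)) (σ + 1) :=
    sat_chainModel_box_one.2 ⟨σ, hσ, rfl, fun v j => ⟨hr, rfl⟩⟩
  cases h : I ⟨r, hr⟩ fun l => σ.testBit l
  · exact .inr (h ▸ this)
  · exact .inl (h ▸ this)

theorem sat_chainModel_choiceV : (chainModel hP hS I x n Ψ).Sat (choiceV k k') 0 := by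
  refine sat_chainModel_rho_four.2 fun s _ _ => ⟨?_, ?_⟩
  · rw [FModel.sat_conj]
    intro θ hθ
    obtain ⟨i, -, rfl⟩ := List.mem_map.1 hθ
    have : (chainModel hP hS I x n Ψ).Sat (valBox i (x i)) s :=
      sat_chainModel_box_one.2 ⟨x i, fun _ => rfl, rfl⟩
    cases h : x i
    · exact .inr (h ▸ this)
    · exact .inl (h ▸ this)
  · rw [FModel.sat_conj]
    intro θ hθ
    obtain ⟨i, -, rfl⟩ := List.mem_map.1 hθ
    exact ⟨sat_chainModel_box_one.2 ⟨true, fun _ => by omega, rfl⟩,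
      sat_chainModel_box_one.2 ⟨false, fun _ => by omega, rfl⟩⟩

theorem sat_chainModel_testForm (hB : B.Suitable (JH P) CS) (hk : 0 < k + k')
    {ψ : Matr m ar k k'} (hΨ : IsOrdering (.neg ψ) Ψ)
    (hψ : ∀ v : ℕ → Bool, (∀ i < k, v i = x i) → ψ.eval I v = true) :
    (chainModel hP hS I x n Ψ).Sat (testForm B Ψ ψ) 0 := by
  refine sat_chainModel_rho_four.2 fun s _ _ => ?_
  rw [FModel.sat_conj]
  simp only [List.mem_cons, List.not_mem_nil, or_false, forall_eq_or_imp, forall_eq]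
  refine ⟨?_, ?_, fun h => ?_⟩
  · rw [matchForm, FModel.sat_conj]
    intro θ hθ
    simp only [List.mem_flatMap, List.mem_map] at hθ
    obtain ⟨l, -, z, -, b, -, rfl⟩ := hθ
    refine sat_chainModel_box_one.2 fun v σ j hj hz hl => ?_
    rw [sat_world_lit] at hl
    have hz : v z = b := hz
    change v (j l) = σ l
    rw [← hj, hz, hl]
  · rw [evalAll, FModel.sat_conj]
    intro θ hθ
    obtain ⟨γ, hγ, rfl⟩ := List.mem_map.1 hθ
    exact judge_accepts_eval hB hΨ hγ _ s fun c φ h => sat_chainModel_box_two.2 fun v _ => h v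
  · obtain ⟨v, hv, h⟩ := (allAccept_of_varFree (hB.varFree B.right (by simp))).app_someAccept
      (someAccept_tTerm hB hk Ψ.length) _ (sat_chainModel_box_two.1 h)
    rw [sat_judge_subVar ((hΨ.2.1 _).2 (Matr.mem_subs_self _)), Matr.eval, hψ v hv] at h
    cases h

theorem satisfiable_reductionForm (hP : ∀ σ ∈ P, σ.Tautology) (hS : (JH P).Schematic CS)
    (hB : B.Suitable (JH P) CS) (hk : 0 < k + k') {ψ : Matr m ar k k'}
    (hΨ : IsOrdering (.neg ψ) Ψ) (h : ψ.TwoElementSatisfiable) :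
    (JH P).Satisfiable CS (reductionForm B Ψ ψ) := by
  obtain ⟨I, x, hx⟩ := ψ.twoElementSatisfiable_iff.1 h
  refine ⟨ℕ, chainModel hP hS I x (maxArity ar) Ψ, 0, ?_⟩
  rw [reductionForm, FModel.sat_conj]
  simp only [List.mem_cons, List.not_mem_nil, or_false, forall_eq_or_imp, forall_eq]
  exact ⟨sat_chainModel_startForm, sat_chainModel_forwardA, sat_chainModel_forwardB,
    sat_chainModel_forwardCD false, sat_chainModel_forwardCD true, sat_chainModel_endForm,
    sat_chainModel_choiceR, sat_chainModel_choiceV, sat_chainModel_testForm hB hk hΨ hx⟩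

end Countermodel

/-! ### Existence of the basic terms -/

section Internalization

variable {N : Type} {J : JLogic N} {CS : ConstSpec N}

/-- No justification occurs in the formula. -/
def JForm.BoxFree : JForm N → Prop
  | .bot => True
  | .var _ => True
  | .neg φ => φ.BoxFree
  | .imp φ χ => φ.BoxFree ∧ χ.BoxFree
  | .and φ χ => φ.BoxFree ∧ χ.BoxFree
  | .or φ χ => φ.BoxFree ∧ χ.BoxFree
  | .box _ _ _ => False

/-- Replacement of the propositional variables `p_n` outside justified formulas. -/
def JForm.replaceP (f : ℕ → JForm N) : JForm N → JForm N
  | .bot => .bot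
  | .var (.p n) => f n
  | .var q => .var q
  | .neg φ => .neg (φ.replaceP f)
  | .imp φ χ => .imp (φ.replaceP f) (χ.replaceP f)
  | .and φ χ => .and (φ.replaceP f) (χ.replaceP f)
  | .or φ χ => .or (φ.replaceP f) (χ.replaceP f)
  | .box t i φ => .box t i φ

theorem PScheme.replaceP_inst (f g : ℕ → JForm N) (σ : PScheme) :
    (σ.inst g).replaceP f = σ.inst fun n => (g n).replaceP f := by
  induction σ <;> simp_all [PScheme.inst, JForm.replaceP]

theorem PScheme.boxFree_inst (σ : PScheme) :
    (σ.inst fun n => (.var (.p n) : JForm N)).BoxFree := by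
  induction σ <;> simp_all [PScheme.inst, JForm.BoxFree]

theorem PScheme.inst_subst (f : ℕ → PScheme) (g : ℕ → JForm N) (σ : PScheme) :
    (σ.subst f).inst g = σ.inst fun n => (f n).inst g := by
  induction σ <;> simp_all [PScheme.inst, PScheme.subst]

/-- A constant that justifies the most general instance of a propositional scheme justifies all
instances, because the specification is schematic. -/
theorem exists_const_of_mem (hS : J.Schematic CS) (hA : J.Appropriate CS) (i : N) {σ : PScheme}
    (hσ : σ ∈ J.P) : ∃ c, ∀ f, CS c i (σ.inst f) := by
  obtain ⟨c, hc⟩ := hA i (σ.inst fun n => .var (.p n)) ⟨.prop σ, hσ, _, rfl⟩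
  refine ⟨c, fun f => ?_⟩
  obtain ⟨T, -, hT⟩ := hS c i
  obtain ⟨S, hST, hSA⟩ := (hT _).1 hc
  have hfree := σ.boxFree_inst (N := N)
  cases S with
  | prop τ =>
    obtain ⟨g, hg⟩ := hSA
    refine (hT _).2 ⟨_, hST, fun n => (g n).replaceP f, ?_⟩
    rw [← τ.replaceP_inst, ← hg, σ.replaceP_inst]
    rfl
  | application i => obtain ⟨s, t, φ, χ, h⟩ := hSA; rw [h] at hfree; exact hfree.1.elim
  | concatLeft i => obtain ⟨s, t, φ, h⟩ := hSA; rw [h] at hfree; exact hfree.1.elim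
  | concatRight i => obtain ⟨s, t, φ, h⟩ := hSA; rw [h] at hfree; exact hfree.1.elim
  | factivity i => obtain ⟨t, φ, h⟩ := hSA; rw [h] at hfree; exact hfree.1.elim
  | consistency i => obtain ⟨t, h⟩ := hSA; rw [h] at hfree; exact hfree.1.elim
  | conversion i j => obtain ⟨t, φ, h⟩ := hSA; rw [h] at hfree; exact hfree.1.elim
  | verification i j => obtain ⟨t, φ, h⟩ := hSA; rw [h] at hfree; exact hfree.1.elim

theorem JLogic.Provable.app {s t : JTerm} {i : N} {φ χ : JForm N}
    (hs : J.Provable CS (.box s i (.imp φ χ))) (ht : J.Provable CS (.box t i φ)) :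
    J.Provable CS (.box (.app s t) i χ) :=
  .mp (.mp (.ax ⟨.application i, trivial, s, t, φ, χ, rfl⟩) hs) ht

/-- Internalization of derivations of propositional schemes. -/
theorem PScheme.Deriv.exists_term (hS : J.Schematic CS) (hA : J.Appropriate CS) (i : N)
    {σ : PScheme} (h : PScheme.Deriv J.P σ) :
    ∃ t : JTerm, t.VarFree ∧ ∀ f, J.Provable CS (.box t i (σ.inst f)) := by
  induction h with
  | ax hσ g =>
    obtain ⟨c, hc⟩ := exists_const_of_mem hS hA i hσ
    exact ⟨.const c, trivial, fun f => .an (.cs (by rw [PScheme.inst_subst]; exact hc _))⟩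
  | mp _ _ ih ih' =>
    obtain ⟨s, hs, hs'⟩ := ih
    obtain ⟨t, ht, ht'⟩ := ih'
    exact ⟨.app s t, ⟨hs, ht⟩, fun f => (hs' f).app (ht' f)⟩

theorem PScheme.Tautology.exists_term {P : Set PScheme} {CS : ConstSpec Agent}
    (hP : PScheme.Axiomatizes P) (hS : (JH P).Schematic CS) (hA : (JH P).Appropriate CS)
    {σ : PScheme} (h : σ.Tautology) : ∃ t : JTerm, t.VarFree ∧
      ∀ i ∈ [Agent.one, Agent.two], ∀ f, (JH P).Provable CS (.box t i (σ.inst f)) := by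
  have hd : PScheme.Deriv (JH P).P σ := hP.complete σ h
  obtain ⟨t₁, h₁, h₁'⟩ := hd.exists_term hS hA .one
  obtain ⟨t₂, h₂, h₂'⟩ := hd.exists_term hS hA .two
  refine ⟨.sum t₁ t₂, ⟨h₁, h₂⟩, fun i hi f => ?_⟩
  simp only [List.mem_cons, List.not_mem_nil, or_false] at hi
  rcases hi with rfl | rfl
  · exact .mp (.ax ⟨.concatLeft .one, trivial, t₁, t₂, _, rfl⟩) (h₁' f)
  · exact .mp (.ax ⟨.concatRight .two, trivial, t₂, t₁, _, rfl⟩) (h₂' f)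

/-- Propositional truth of a formula when `t :_i φ` counts as true unless `φ` is `p_1`. -/
def JForm.BoxEval : JForm N → Prop
  | .bot => False
  | .var _ => True
  | .neg φ => ¬ φ.BoxEval
  | .imp φ χ => φ.BoxEval → χ.BoxEval
  | .and φ χ => φ.BoxEval ∧ χ.BoxEval
  | .or φ χ => φ.BoxEval ∨ χ.BoxEval
  | .box _ _ φ => φ ≠ .var (.p 1)

theorem PScheme.boxEval_inst (f : ℕ → JForm N) (σ : PScheme) :
    (σ.inst f).BoxEval ↔ σ.Eval fun n => (f n).BoxEval := by
  induction σ <;> simp_all [PScheme.inst, PScheme.Eval, JForm.BoxEval]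

/-- The application axiom is not an instance of a tautology, so that a constant can justify its
most general instance only by justifying the whole scheme. -/
theorem exists_const_application (hP : ∀ σ ∈ J.P, σ.Tautology) (hS : J.Schematic CS)
    (hA : J.Appropriate CS) (i j : N) : ∃ c, ∀ s t φ χ, CS c i
      (.imp (.box s j (.imp φ χ)) (.imp (.box t j φ) (.box (.app s t) j χ))) := by
  have hax : J.IsAxiom (.imp (.box (.const 0) j (.imp (.var (.p 0)) (.var (.p 1))))
      (.imp (.box (.const 0) j (.var (.p 0)))
        (.box (.app (.const 0) (.const 0)) j (.var (.p 1))))) :=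
    ⟨.application j, trivial, _, _, _, _, rfl⟩
  obtain ⟨c, hc⟩ := hA i _ hax
  obtain ⟨T, hT', hT⟩ := hS c i
  obtain ⟨S, hST, hSA⟩ := (hT _).1 hc
  refine ⟨c, fun s t φ χ => (hT _).2 ⟨S, hST, ?_⟩⟩
  cases S with
  | prop τ =>
    obtain ⟨g, hg⟩ := hSA
    have h := (PScheme.boxEval_inst g τ).2 (hP τ (hT' _ hST) _)
    rw [← hg] at h
    exact absurd (h (by simp [JForm.BoxEval]) (by simp [JForm.BoxEval])) (by simp [JForm.BoxEval])
  | application i =>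
    obtain ⟨_, _, _, _, h⟩ := hSA
    simp only [JForm.imp.injEq, JForm.box.injEq] at h
    obtain ⟨⟨-, rfl, -⟩, -⟩ := h
    exact ⟨s, t, φ, χ, rfl⟩
  | concatLeft i => obtain ⟨_, _, _, h⟩ := hSA; simp at h
  | concatRight i => obtain ⟨_, _, _, h⟩ := hSA; simp at h
  | factivity i => obtain ⟨_, _, h⟩ := hSA; simp at h; simp [← h.1.2.2] at h
  | consistency i => obtain ⟨_, h⟩ := hSA; simp at h
  | conversion i j => obtain ⟨_, _, h⟩ := hSA; simp at h
  | verification i j => obtain ⟨_, _, h⟩ := hSA; simp at h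

end Internalization

open PScheme in
theorem exists_suitable {P : Set PScheme} {CS : ConstSpec Agent} (hP : Axiomatizes P)
    (hS : (JH P).Schematic CS) (hA : (JH P).Appropriate CS) :
    ∃ B : BasicTerms, B.Suitable (JH P) CS := by
  have key : ∀ σ : PScheme, σ.Tautology → ∃ t : JTerm, t.VarFree ∧
      ∀ i ∈ [Agent.one, Agent.two], ∀ f, (JH P).Provable CS (.box t i (σ.inst f)) :=
    fun σ h => h.exists_term hP hS hA
  let A := PScheme.var 0
  let B := PScheme.var 1
  let C := PScheme.var 2
  obtain ⟨t₁, v₁, h₁⟩ := key (imp A (imp B (and A B)))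
    (by intro v; simp only [A, B, PScheme.Eval]; tauto)
  obtain ⟨t₂, v₂, h₂⟩ := key (imp (imp A B) (imp A (and A B)))
    (by intro v; simp only [A, B, PScheme.Eval]; tauto)
  obtain ⟨t₃, v₃, h₃⟩ := key (imp (imp A B) (imp (imp A C) (imp A (and B C))))
    (by intro v; simp only [A, B, C, PScheme.Eval]; tauto)
  obtain ⟨t₄, v₄, h₄⟩ := key (imp (and A B) A) (by intro v; simp only [A, B, PScheme.Eval]; tauto)
  obtain ⟨t₅, v₅, h₅⟩ := key (imp (and A B) B) (by intro v; simp only [A, B, PScheme.Eval]; tauto)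
  obtain ⟨t₆, v₆, h₆⟩ := key (imp A A) (by intro v; simp only [A, PScheme.Eval]; tauto)
  obtain ⟨t₇, v₇, h₇⟩ := key (imp (imp A B) (imp (imp B C) (imp A C)))
    (by intro v; simp only [A, B, C, PScheme.Eval]; tauto)
  obtain ⟨t₈, v₈, h₈⟩ := key (imp A (imp B A)) (by intro v; simp only [A, B, PScheme.Eval]; tauto)
  obtain ⟨t₉, v₉, h₉⟩ := key (imp (imp A B) (imp (and A C) (and B C)))
    (by intro v; simp only [A, B, C, PScheme.Eval]; tauto)
  obtain ⟨u₁, w₁, k₁⟩ := key (imp (imp B C) (imp (and A B) (and A C)))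
    (by intro v; simp only [A, B, C, PScheme.Eval]; tauto)
  obtain ⟨u₂, w₂, k₂⟩ := key (imp (imp A B) (imp (imp A (imp B C)) (imp A C)))
    (by intro v; simp only [A, B, C, PScheme.Eval]; tauto)
  obtain ⟨c, hc⟩ := exists_const_application (J := JH P) hP.sound hS hA .two .one
  -- `f φ χ θ` substitutes `φ`, `χ`, `θ` for the metavariables `A`, `B`, `C`
  let f : JForm Agent → JForm Agent → JForm Agent → ℕ → JForm Agent := fun φ χ θ n =>
    match n with
    | 0 => φ
    | 1 => χ
    | _ => θ
  refine ⟨⟨t₁, t₂, t₃, t₄, t₅, t₆, t₇, t₈, t₉, u₁, u₂, c⟩, ⟨?_,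
    fun i hi φ χ => h₁ i hi (f φ χ χ), fun i hi φ χ => h₂ i hi (f φ χ χ),
    fun i hi φ χ θ => h₃ i hi (f φ χ θ), fun i hi φ χ => h₄ i hi (f φ χ χ),
    fun i hi φ χ => h₅ i hi (f φ χ χ), fun i hi φ => h₆ i hi (f φ φ φ),
    fun i hi φ χ θ => h₇ i hi (f φ χ θ), fun i hi φ χ => h₈ i hi (f φ χ χ),
    fun i hi φ χ θ => h₉ i hi (f φ χ θ), fun i hi φ χ θ => k₁ i hi (f φ χ θ),
    fun i hi φ χ θ => k₂ i hi (f φ χ θ), hc⟩⟩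
  simp only [List.mem_cons, List.not_mem_nil, or_false, forall_eq_or_imp, forall_eq]
  exact ⟨v₁, v₂, v₃, v₄, v₅, v₆, v₇, v₈, v₉, w₁, w₂⟩

theorem mainTheorem5
    (P : Set PScheme) (hP : PScheme.Axiomatizes P)
    (CS : ConstSpec Agent) (hS : (JH P).Schematic CS) (hA : (JH P).Appropriate CS)
    (m : ℕ) (ar : Fin m → ℕ) (k k' : ℕ) (hk : 0 < k + k') (ψ : Matr m ar k k') :
    (∃ (B : BasicTerms) (Ψ : List (Matr m ar k k')),
      B.Suitable (JH P) CS ∧ IsOrdering (.neg ψ) Ψ) ∧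
    ∀ (B : BasicTerms) (Ψ : List (Matr m ar k k')),
      B.Suitable (JH P) CS → IsOrdering (.neg ψ) Ψ →
        ((JH P).Satisfiable CS (reductionForm B Ψ ψ) ↔ ψ.TwoElementSatisfiable) ∧
        ∀ (W : Type) (M : FModel (JH P) CS W) (a : W), M.Sat (reductionForm B Ψ ψ) a →
          HasTupleChain M (maxArity ar) m a := by
  refine ⟨?_, fun B Ψ hB hΨ => ?_⟩
  · obtain ⟨B, hB⟩ := exists_suitable hP hS hA
    obtain ⟨Ψ, hΨ⟩ := exists_isOrdering (Matr.neg ψ)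
    exact ⟨B, Ψ, hB, hΨ⟩
  · have hchain : ∀ (W : Type) (M : FModel (JH P) CS W) (a : W),
        M.Sat (reductionForm B Ψ ψ) a → HasTupleChain M (maxArity ar) m a := by
      intro W M a h
      rw [reductionForm, M.sat_conj] at h
      exact M.hasTupleChain (h _ (by simp)) (h _ (by simp)) (h _ (by simp)) (h _ (by simp))
        (h _ (by simp)) (h _ (by simp)) (h _ (by simp))
    refine ⟨⟨?_, satisfiable_reductionForm hP.sound hS hB hk hΨ⟩, hchain⟩
    rintro ⟨W, M, a, h⟩
    have hch := hchain W M a h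
    rw [reductionForm, M.sat_conj] at h
    exact M.twoElementSatisfiable hP.sound hS hB hk hΨ hch (h _ (by simp)) (h _ (by simp))
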